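/- Conventions. Manifolds are smooth ($C^\infty$), Hausdorff, second countable and without boundary; they need not be connected, compact or complete. Let $(g_r)_{r\in\mathbb R}$ be a smooth family of Riemannian metrics on a manifold $B$, i.e. $dr^2+g_r$ is a smooth Riemannian metric on $\mathbb R\times B$. The family is called *simultaneously diagonalizable* if near each point of $B$ there is a smooth frame of vector fields $\{X_i\}$ on $B$ that is $g_r$-orthogonal for every $r\in\mathbb R$. Write $\mathrm{I\!I}_{g_r}$ for the second fundamental form of the slice $\{r\}\times B$ in $(\mathbb R\times B,\,dr^2+g_r)$ with respect to the unit normal $\partial_r$, i.e. $\mathrm{I\!I}_{g_r}(X,Y)=\langle\nabla_XY,\partial_r\rangle$ for $X,Y$ tangent to the slice, where $\nabla$ is the Levi-Civita connection of $dr^2+g_r$. It is negative definite for all $r$ if $\mathrm{I\!I}_{g_r}(X,X)<0$ for every $r$ and every nonzero $X$ tangent to $B$, and bounded if there is a constant $C$, independent of $r$ and of the point, with $|\mathrm{I\!I}_{g_r}(X,Y)|\le C\,|X|_{g_r}|Y|_{g_r}$. $K$ denotes sectional curvature: $K<0$ means that every tangent $2$-plane has negative sectional curvature, and $K$ is bounded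 if there is a constant $C$ with $|K|\le C$ for all tangent $2$-planes at all points. $\mathrm{Vol}$ is the Riemannian measure, and $\mathbb R_-=(-\infty,0)$. Theorem. For $k=1,2$ let $B_k$ be a manifold and let $(g_{r,k})_{r\in\mathbb R}$ be a smooth, simultaneously diagonalizable family of Riemannian metrics on $B_k$. Let $g_r=g_{r,1}+g_{r,2}$ be the product metrics on $B_1\times B_2$ and let $g=dr^2+g_r$ on $\mathbb R\times B_1\times B_2$. Suppose that $\mathrm{I\!I}_{g_r}$ is negative definite for all $r$. Then: (1) If $K_{dr^2+g_{r,1}}<0$ and $K_{dr^2+g_{r,2}}<0$, then $K_g<0$. (2) If $K_{dr^2+g_{r,1}}$, $K_{dr^2+g_{r,2}}$ and $\mathrm{I\!I}_{g_r}$ are bounded, then $K_g$ is bounded. (3) If for some $k\in\{1,2\}$ both $\mathrm{Vol}(\mathbb R_-\times B_k,\,dr^2+g_{r,k})$ and $\mathrm{Vol}(B_{3-k},\,g_{0,3-k})$ are finite, then $\mathrm{Vol}(\mathbb R_-\times B_1\times B_2,\,g)$ is finite. -/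

import Mathlib

open MeasureTheory Bundle
open scoped Manifold ContDiff ENNReal

noncomputable section

namespace CylinderGeometry

/-! ### Riemannian geometry on a manifold without boundary, in charts -/

section Manifold

variable {E : Type*} [NormedAddCommGroup E] [NormedSpace ℝ E]
  {H : Type*} [TopologicalSpace H] (I : ModelWithCorners ℝ E H)
  {M : Type*} [TopologicalSpace M] [ChartedSpace H M]

/-- Fields of bilinear forms on the tangent spaces of `M` (no regularity imposed). -/
abbrev FormField (M : Type*) [TopologicalSpace M] [ChartedSpace H M] :=
  ∀ p : M, TangentSpace I p →L[ℝ] TangentSpace I p →L[ℝ] ℝ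

variable {I}

/-- The field of bilinear forms `g` is a smooth (`C^∞`) Riemannian metric on `M`. -/
def IsRiemannianMetric [IsManifold I ∞ M] (g : FormField I M) : Prop :=
  ∃ m : ContMDiffRiemannianMetric I ∞ E (fun p : M => TangentSpace I p), m.inner = g

/-- The expression of `g` in the preferred chart `φ` at `x₀`: at a point `y` of the target of `φ`,
it is the pull-back of `g` by `φ⁻¹`. -/
def inChart (g : FormField I M) (x₀ : M) (y : E) : E →L[ℝ] E →L[ℝ] ℝ :=
  let D : TangentSpace 𝓘(ℝ, E) y →L[ℝ] TangentSpace I ((extChartAt I x₀).symm y) :=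
    mfderiv 𝓘(ℝ, E) I (extChartAt I x₀).symm y
  (ContinuousLinearMap.precomp ℝ D).comp ((g ((extChartAt I x₀).symm y)).comp D)

/-- The coordinates of a tangent vector at `p` in the preferred chart at `p`. -/
def coords (p : M) (v : TangentSpace I p) : E :=
  mfderiv I 𝓘(ℝ, E) (extChartAt I p) p v

end Manifold

section Coordinates

variable {E : Type*} [NormedAddCommGroup E] [NormedSpace ℝ E]

/-- The Christoffel symbols `Γ_y(v, w) = ∇_v w` (for constant vector fields `v`, `w`) of the
Levi-Civita connection of a metric `G` on a domain of `E`; this is the vector determined by the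
Koszul formula
`2 G(Γ(v, w), z) = (∂_v G)(w, z) + (∂_w G)(v, z) - (∂_z G)(v, w)` for all `z`. -/
def christoffel (G : E → E →L[ℝ] E →L[ℝ] ℝ) (y v w : E) : E :=
  (2⁻¹ : ℝ) • (G y).inverse
    (fderiv ℝ G y v w + fderiv ℝ G y w v - ((fderiv ℝ G y).flip v).flip w)

/-- The Riemann curvature tensor
`R(u, v) w = ∇_u ∇_v w - ∇_v ∇_u w`, for constant vector fields `u`, `v`, `w` on a domain of `E`. -/
def riemann (G : E → E →L[ℝ] E →L[ℝ] ℝ) (y u v w : E) : E :=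
  fderiv ℝ (fun x => christoffel G x v w) y u + christoffel G y u (christoffel G y v w)
    - (fderiv ℝ (fun x => christoffel G x u w) y v + christoffel G y v (christoffel G y u w))

end Coordinates

section Manifold

variable {E : Type*} [NormedAddCommGroup E] [NormedSpace ℝ E]
  {H : Type*} [TopologicalSpace H] {I : ModelWithCorners ℝ E H}
  {M : Type*} [TopologicalSpace M] [ChartedSpace H M]

/-- The sectional curvature
`⟨R(u, v) v, u⟩ / (⟨u, u⟩ ⟨v, v⟩ - ⟨u, v⟩ ^ 2)` of the plane spanned by `u` and `v`. -/
def sectionalCurvature (g : FormField I M) (p : M) (u v : TangentSpace I p) : ℝ :=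
  let y := extChartAt I p p
  inChart g p y (riemann (inChart g p) y (coords p u) (coords p v) (coords p v)) (coords p u)
    / (g p u u * g p v v - g p u v ^ 2)

/-- `K_g < 0`: all tangent planes have negative sectional curvature. -/
def NegativeCurvature (g : FormField I M) : Prop :=
  ∀ (p : M) (u v : TangentSpace I p), LinearIndependent ℝ ![u, v] → sectionalCurvature g p u v < 0

/-- The sectional curvatures of all tangent planes are uniformly bounded (above and below). -/
def BoundedCurvature (g : FormField I M) : Prop :=
  ∃ C : ℝ, ∀ (p : M) (u v : TangentSpace I p), LinearIndependent ℝ ![u, v] →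
    |sectionalCurvature g p u v| ≤ C

variable [FiniteDimensional ℝ E] [MeasurableSpace E] [BorelSpace E] [MeasurableSpace M]

/-- The Riemannian measure of the domain of the preferred chart at `x₀`, extended by zero: in
coordinates with respect to a basis of `E` it is `√(det g_ij) dy`, where `dy` gives measure one to
the parallelepiped spanned by the basis (the result does not depend on the basis). -/
def chartVolume (g : FormField I M) (x₀ : M) : Measure M :=
  let b := Module.finBasis ℝ E
  Measure.map (extChartAt I x₀).symm
    ((b.addHaar.restrict (extChartAt I x₀).target).withDensity fun y =>
      ENNReal.ofReal (Real.sqrt (Matrix.of fun i j => inChart g x₀ y (b i) (b j)).det))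

/-- The Riemannian measure, as the least measure that dominates the Riemannian measures of all chart
domains. Since the latter agree on overlaps, on a second countable manifold this is the unique
measure whose restriction to the domain of the chart at `x₀` is `chartVolume g x₀`, for every
`x₀`. -/
def riemannianVolume (g : FormField I M) : Measure M :=
  ⨆ x₀ : M, chartVolume g x₀

end Manifold

/-! ### Families of metrics and the metrics `dr² + g_r` -/

section Families

variable {E : Type*} [NormedAddCommGroup E] [NormedSpace ℝ E]
  {H : Type*} [TopologicalSpace H] {I : ModelWithCorners ℝ E H}
  {B : Type*} [TopologicalSpace B] [ChartedSpace H B]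

/-- The field of forms `dr² + g_r` on `ℝ × B`. -/
def cylinder (g : ℝ → FormField I B) : FormField (𝓘(ℝ, ℝ).prod I) (ℝ × B) := fun p =>
  let pr₁ : TangentSpace (𝓘(ℝ, ℝ).prod I) p →L[ℝ] ℝ := ContinuousLinearMap.fst ℝ ℝ E
  let pr₂ : TangentSpace (𝓘(ℝ, ℝ).prod I) p →L[ℝ] TangentSpace I p.2 :=
    ContinuousLinearMap.snd ℝ ℝ E
  (ContinuousLinearMap.precomp ℝ pr₁).comp ((ContinuousLinearMap.mul ℝ ℝ).comp pr₁)
    + (ContinuousLinearMap.precomp ℝ pr₂).comp ((g p.1 p.2).comp pr₂)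

/-- `g_r`, `r ∈ ℝ`, is a smooth family of Riemannian metrics on `B`, that is, `dr² + g_r` is a
smooth Riemannian metric on `ℝ × B`. -/
def IsMetricFamily [IsManifold I ∞ B] (g : ℝ → FormField I B) : Prop :=
  IsRiemannianMetric (cylinder g)

/-- Near each point of `B` there is a smooth frame `X_i` which is `g_r`-orthogonal for each `r`. -/
def SimultaneouslyDiagonalizable [IsManifold I ∞ B] (g : ℝ → FormField I B) : Prop :=
  ∀ b : B, ∃ U : Set B, IsOpen U ∧ b ∈ U ∧
    ∃ X : Fin (Module.finrank ℝ E) → (x : B) → TangentSpace I x,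
      IsLocalFrameOn I E ∞ X U ∧
      ∀ (r : ℝ), ∀ x ∈ U, ∀ i j, i ≠ j → g r x (X i x) (X j x) = 0

/-- The second fundamental form of the slice `{r} × B` (with the metric `g_r`) in
`(ℝ × B, dr² + g_r)`, with respect to the unit normal `∂_r`: the number `⟨∇_v w, ∂_r⟩`, so that
`II(v, w) = secondFundamentalForm g r b v w • ∂_r`. -/
def secondFundamentalForm (g : ℝ → FormField I B) (r : ℝ) (b : B) (v w : TangentSpace I b) : ℝ :=
  let p : ℝ × B := (r, b)
  let y := extChartAt (𝓘(ℝ, ℝ).prod I) p p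
  inChart (cylinder g) p y
    (christoffel (inChart (cylinder g) p) y (0, coords b v) (0, coords b w)) (1, 0)

/-- The second fundamental forms of all the slices are negative definite. -/
def NegativeDefiniteII (g : ℝ → FormField I B) : Prop :=
  ∀ (r : ℝ) (b : B) (v : TangentSpace I b), v ≠ 0 → secondFundamentalForm g r b v v < 0

/-- The norms of the second fundamental forms of the slices are uniformly bounded. -/
def BoundedII (g : ℝ → FormField I B) : Prop :=
  ∃ C : ℝ, ∀ (r : ℝ) (b : B) (v w : TangentSpace I b),
    |secondFundamentalForm g r b v w| ≤ C * √(g r b v v) * √(g r b w w)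

variable {E' : Type*} [NormedAddCommGroup E'] [NormedSpace ℝ E']
  {H' : Type*} [TopologicalSpace H'] {I' : ModelWithCorners ℝ E' H'}
  {B' : Type*} [TopologicalSpace B'] [ChartedSpace H' B']

/-- The family of product metrics `g_r + g'_r` on `B × B'`. -/
def prodFamily (g : ℝ → FormField I B) (g' : ℝ → FormField I' B') :
    ℝ → FormField (I.prod I') (B × B') := fun r p =>
  let pr₁ : TangentSpace (I.prod I') p →L[ℝ] TangentSpace I p.1 := ContinuousLinearMap.fst ℝ E E'
  let pr₂ : TangentSpace (I.prod I') p →L[ℝ] TangentSpace I' p.2 := ContinuousLinearMap.snd ℝ E E'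
  (ContinuousLinearMap.precomp ℝ pr₁).comp ((g r p.1).comp pr₁)
    + (ContinuousLinearMap.precomp ℝ pr₂).comp ((g' r p.2).comp pr₂)

end Families

end CylinderGeometry

end

noncomputable section

set_option maxSynthPendingDepth 3

namespace CylinderGeometry

/-! ### Christoffel symbols and the Koszul formula in coordinates. -/

section Christoffel

variable {E : Type*} [NormedAddCommGroup E] [NormedSpace ℝ E]

/-! Everything rests on one curvature formula. In product charts, `dr² + g_r + g'_r` is the sum of
the pull-backs of `G₁ = dr² + g_r` and `G₂ = dr² + g'_r` minus one copy of `dr²` (`sumForm`). Its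
Christoffel symbols are the sums of those of `G₁` and `G₂` (`christoffel_sumForm`). The two factors
therefore interact only through the `∂_r`-components of these symbols, which are the second
fundamental forms. With `S₁`, `S₂` the negatives of these forms, and `u = (·, x, y)`, `v = (·, x',
y')`, this gives `⟨R(u, v)v, u⟩ = ⟨R₁(u, v)v, u⟩ + ⟨R₂(u, v)v, u⟩ - (S₁ ⊗ S₂)(x ⊗ y' - x' ⊗ y)`,
where the last term means the value of the quadratic form (`curvatureForm_sumForm`, `mixedForm`).

Negative curvature: `S₁` and `S₂` are positive definite, so no term on the right is positive. If the
plane degenerates under both projections, the first two terms vanish, but then the mixed term is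
strictly positive (`mixedForm_pos`).

Bounded curvature: the squared area of the parallelogram on `u`, `v` splits in the same way, with
`g_r ⊗ g'_r` in the mixed term (`gram_sumForm`). The bounds `S_k ≤ C g_k` give `S₁ ⊗ S₂ ≤ C² g_r ⊗
g'_r` (`mixedForm_le`), so numerator and denominator are compared term by term.

Finite volume: `∂_r g'_r = 2 S₂ ≥ 0`, so `g'_r ≤ g'_0` for `r ≤ 0`. A frame orthogonal for all `r`
turns this into an inequality of determinants (`NegativeDefiniteII.gramDet_le`). Over the negative
reals the volume is then at most a constant times that of the product of `dr² + g_r` with the fixed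
metric `g'_0`, which is a product of two finite volumes. The other case is symmetric. -/

lemma isInvertible_of_pos [FiniteDimensional ℝ E] {A : E →L[ℝ] E →L[ℝ] ℝ}
    (hA : ∀ v, v ≠ 0 → 0 < A v v) : A.IsInvertible := by
  have hinj : Function.Injective A.toLinearMap := by
    refine (injective_iff_map_eq_zero _).2 fun v hv => ?_
    by_contra h
    have := hA v h
    have h0 : A v = 0 := hv
    simp [h0] at this
  have hfin : Module.finrank ℝ E = Module.finrank ℝ (E →L[ℝ] ℝ) := by
    rw [← (LinearMap.toContinuousLinearMap (𝕜 := ℝ) (E := E) (F' := ℝ)).finrank_eq]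
    exact Subspace.dual_finrank_eq.symm
  let e := (LinearEquiv.ofInjectiveOfFinrankEq A.toLinearMap hinj hfin).toContinuousLinearEquiv
  exact ⟨e, by ext v w; rfl⟩

lemma christoffel_add_left (G : E → E →L[ℝ] E →L[ℝ] ℝ) (y v v' w : E) :
    christoffel G y (v + v') w = christoffel G y v w + christoffel G y v' w := by
  simp only [christoffel, ← smul_add, ← map_add]
  congr 2
  ext z
  simp
  ring

lemma christoffel_add_right (G : E → E →L[ℝ] E →L[ℝ] ℝ) (y v w w' : E) :
    christoffel G y v (w + w') = christoffel G y v w + christoffel G y v w' := by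
  simp only [christoffel, ← smul_add, ← map_add]
  congr 2
  ext z
  simp
  ring

lemma christoffel_smul_left (G : E → E →L[ℝ] E →L[ℝ] ℝ) (y : E) (c : ℝ) (v w : E) :
    christoffel G y (c • v) w = c • christoffel G y v w := by
  simp only [christoffel, smul_comm c, ← map_smul]
  congr 2
  ext z
  simp
  ring

lemma christoffel_smul_right (G : E → E →L[ℝ] E →L[ℝ] ℝ) (y : E) (c : ℝ) (v w : E) :
    christoffel G y v (c • w) = c • christoffel G y v w := by
  simp only [christoffel, smul_comm c, ← map_smul]
  congr 2
  ext z
  simp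
  ring

/-- By bilinearity both halves of the curvature equal `a * b` times the same vector. No metric
property of `G` is needed, so degenerate planes can be discarded freely. -/
lemma riemann_smul_smul (G : E → E →L[ℝ] E →L[ℝ] ℝ) (y : E) (a b : ℝ) (e w : E) :
    riemann G y (a • e) (b • e) w = 0 := by
  have h (c : ℝ) : (fun x => christoffel G x (c • e) w) = c • fun x => christoffel G x e w := by
    funext x
    exact christoffel_smul_left G x c e w
  rw [riemann, h, h, fderiv_const_smul_field, fderiv_const_smul_field]
  simp only [Pi.smul_apply, smul_apply, map_smul, christoffel_smul_left, christoffel_smul_right, smul_smul,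
    mul_comm a b, sub_self]

lemma christoffel_congr {G G' : E → E →L[ℝ] E →L[ℝ] ℝ} {y : E} (h : G =ᶠ[nhds y] G')
    (v w : E) : christoffel G y v w = christoffel G' y v w := by
  rw [christoffel, christoffel, h.fderiv_eq, h.eq_of_nhds]

lemma riemann_congr {G G' : E → E →L[ℝ] E →L[ℝ] ℝ} {y : E} (h : G =ᶠ[nhds y] G')
    (u v w : E) : riemann G y u v w = riemann G' y u v w := by
  have h' (v w : E) :
      (fun x => christoffel G x v w) =ᶠ[nhds y] fun x => christoffel G' x v w := by
    filter_upwards [h.eventuallyEq_nhds] with x hx using christoffel_congr hx v w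
  simp only [riemann, (h' _ _).fderiv_eq, christoffel_congr h]

variable [FiniteDimensional ℝ E]

/-- The Koszul formula. -/
lemma two_mul_christoffel_apply {G : E → E →L[ℝ] E →L[ℝ] ℝ} {y : E}
    (hG : ∀ v, v ≠ 0 → 0 < G y v v) (v w z : E) :
    2 * G y (christoffel G y v w) z =
      fderiv ℝ G y v w z + fderiv ℝ G y w v z - fderiv ℝ G y z v w := by
  obtain ⟨e, he⟩ := isInvertible_of_pos hG
  have h (f : E →L[ℝ] ℝ) : G y ((G y).inverse f) = f := by
    rw [← he, ContinuousLinearMap.inverse_equiv]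
    exact e.apply_symm_apply f
  rw [christoffel, map_smul, h]
  simp

/-- Nondegeneracy makes the Koszul formula characteristic; Christoffel symbols are later identified
by guessing them and testing against all `z`. -/
lemma eq_christoffel {G : E → E →L[ℝ] E →L[ℝ] ℝ} {y : E}
    (hG : ∀ v, v ≠ 0 → 0 < G y v v) {v w c : E}
    (hc : ∀ z, 2 * G y c z =
      fderiv ℝ G y v w z + fderiv ℝ G y w v z - fderiv ℝ G y z v w) :
    c = christoffel G y v w := by
  by_contra h
  have h1 := hG _ (sub_ne_zero.2 h)
  have h2 := hc (c - christoffel G y v w)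
  rw [← two_mul_christoffel_apply hG] at h2
  rw [map_sub, map_sub, sub_apply, sub_apply] at h1
  simp only [map_sub] at h2
  linarith

lemma differentiableAt_christoffel {G : E → E →L[ℝ] E →L[ℝ] ℝ} {y : E}
    (hG : ∀ v, v ≠ 0 → 0 < G y v v) (hs : ContDiffAt ℝ ∞ G y) (v w : E) :
    DifferentiableAt ℝ (fun x => christoffel G x v w) y := by
  have h1 : DifferentiableAt ℝ (fun x => (G x).inverse) y :=
    ((isInvertible_of_pos hG).contDiffAt_map_inverse (n := 1)).differentiableAt (by simp)
      |>.comp y (hs.differentiableAt (by simp))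
  have h2 : DifferentiableAt ℝ (fderiv ℝ G) y :=
    (hs.fderiv_right (m := 1) (by norm_cast)).differentiableAt (by simp)
  unfold christoffel
  have h3 : DifferentiableAt ℝ (fun x => ((fderiv ℝ G x).flip v).flip w) y := by
    let L₁ : (E →L[ℝ] E →L[ℝ] E →L[ℝ] ℝ) →L[ℝ] E →L[ℝ] E →L[ℝ] E →L[ℝ] ℝ :=
      (ContinuousLinearMap.flipₗᵢ ℝ E E (E →L[ℝ] ℝ)).toContinuousLinearEquiv
    let L₂ : (E →L[ℝ] E →L[ℝ] ℝ) →L[ℝ] E →L[ℝ] E →L[ℝ] ℝ :=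
      (ContinuousLinearMap.flipₗᵢ ℝ E E ℝ).toContinuousLinearEquiv
    have h4 : DifferentiableAt ℝ (fun x => L₁ (fderiv ℝ G x)) y :=
      (L₁.differentiableAt (x := fderiv ℝ G y)).comp y h2
    have h5 : DifferentiableAt ℝ (fun x => L₁ (fderiv ℝ G x) v) y :=
      h4.clm_apply (differentiableAt_const v)
    have h6 : DifferentiableAt ℝ (fun x => L₂ (L₁ (fderiv ℝ G x) v)) y :=
      (L₂.differentiableAt (x := L₁ (fderiv ℝ G y) v)).comp y h5
    exact h6.clm_apply (differentiableAt_const w)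
  have h4 : DifferentiableAt ℝ (fun x => fderiv ℝ G x v w) y :=
    (h2.clm_apply (differentiableAt_const v)).clm_apply (differentiableAt_const w)
  have h5 : DifferentiableAt ℝ (fun x => fderiv ℝ G x w v) y :=
    (h2.clm_apply (differentiableAt_const w)).clm_apply (differentiableAt_const v)
  exact (h1.clm_apply ((h4.add h5).sub h3)).const_smul _

end Christoffel

/-! ### Metrics of the form `dr² + g_r` on open sets of `ℝ × E`. -/

section Cylindrical

variable {E : Type*} [NormedAddCommGroup E] [NormedSpace ℝ E]

/-- `G` is a smooth metric of the form `dr² + g_r` on the open subset `U` of `ℝ × E`. -/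
structure IsCylindricalOn (G : ℝ × E → (ℝ × E) →L[ℝ] (ℝ × E) →L[ℝ] ℝ) (U : Set (ℝ × E)) :
    Prop where
  isOpen : IsOpen U
  contDiffOn : ContDiffOn ℝ ∞ G U
  symm : ∀ x ∈ U, ∀ v w, G x v w = G x w v
  pos : ∀ x ∈ U, ∀ v, v ≠ 0 → 0 < G x v v
  normal : ∀ x ∈ U, ∀ v, G x (1, 0) v = v.1

lemma fderiv_apply_apply {F : Type*} [NormedAddCommGroup F] [NormedSpace ℝ F]
    {G : F → F →L[ℝ] F →L[ℝ] ℝ} {x : F} (hG : DifferentiableAt ℝ G x) (u v w : F) :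
    fderiv ℝ G x u v w = fderiv ℝ (fun y => G y v w) x u := by
  have h := (hG.hasFDerivAt.clm_apply (hasFDerivAt_const v x)).clm_apply (hasFDerivAt_const w x)
  rw [h.fderiv]
  simp

namespace IsCylindricalOn

variable {G : ℝ × E → (ℝ × E) →L[ℝ] (ℝ × E) →L[ℝ] ℝ} {U : Set (ℝ × E)} {x : ℝ × E}

lemma contDiffAt (hG : IsCylindricalOn G U) (hx : x ∈ U) : ContDiffAt ℝ ∞ G x :=
  hG.contDiffOn.contDiffAt (hG.isOpen.mem_nhds hx)

lemma differentiableAt (hG : IsCylindricalOn G U) (hx : x ∈ U) : DifferentiableAt ℝ G x :=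
  (hG.contDiffAt hx).differentiableAt (by simp)

lemma fderiv_symm (hG : IsCylindricalOn G U) (hx : x ∈ U) (u v w : ℝ × E) :
    fderiv ℝ G x u v w = fderiv ℝ G x u w v := by
  rw [fderiv_apply_apply (hG.differentiableAt hx), fderiv_apply_apply (hG.differentiableAt hx)]
  congr 1
  refine Filter.EventuallyEq.fderiv_eq ?_
  filter_upwards [hG.isOpen.mem_nhds hx] with y hy using hG.symm y hy v w

lemma fderiv_normal (hG : IsCylindricalOn G U) (hx : x ∈ U) (u w : ℝ × E) :
    fderiv ℝ G x u (1, 0) w = 0 := by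
  rw [fderiv_apply_apply (hG.differentiableAt hx)]
  have : (fun y => G y (1, 0) w) =ᶠ[nhds x] fun _ => w.1 := by
    filter_upwards [hG.isOpen.mem_nhds hx] with y hy using hG.normal y hy w
  rw [this.fderiv_eq]
  simp

variable [FiniteDimensional ℝ E]

/-- Take `z = ∂_r` in the Koszul formula: since `G(∂_r, ·) = dr` has constant coefficients, only the
derivative in the direction `∂_r` survives. -/
lemma christoffel_fst (hG : IsCylindricalOn G U) (hx : x ∈ U) (v w : ℝ × E) :
    2 * (christoffel G x v w).1 = -fderiv ℝ G x (1, 0) v w := by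
  have h := two_mul_christoffel_apply (hG.pos x hx) v w (1, 0)
  rw [hG.symm x hx, hG.normal x hx, hG.fderiv_symm hx v, hG.fderiv_normal hx,
    hG.fderiv_symm hx w, hG.fderiv_normal hx] at h
  linarith

lemma christoffel_fst_symm (hG : IsCylindricalOn G U) (hx : x ∈ U) (v w : ℝ × E) :
    (christoffel G x v w).1 = (christoffel G x w v).1 := by
  have h := hG.christoffel_fst hx v w
  rw [hG.fderiv_symm hx, ← hG.christoffel_fst hx w v] at h
  linarith

lemma christoffel_fst_normal (hG : IsCylindricalOn G U) (hx : x ∈ U) (w : ℝ × E) :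
    (christoffel G x (1, 0) w).1 = 0 := by
  have h := hG.christoffel_fst hx (1, 0) w
  rw [hG.fderiv_normal hx] at h
  linarith

lemma christoffel_fst_eq (hG : IsCylindricalOn G U) (hx : x ∈ U) (v w : ℝ × E) :
    (christoffel G x v w).1 = (christoffel G x (0, v.2) (0, w.2)).1 := by
  have h (a : ℝ × E) : a = a.1 • ((1 : ℝ), (0 : E)) + (0, a.2) := by ext <;> simp
  conv_lhs => rw [h v, h w]
  simp only [christoffel_add_left, christoffel_add_right, christoffel_smul_left,
    christoffel_smul_right, Prod.fst_add, Prod.smul_fst, hG.christoffel_fst_normal hx,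
    hG.christoffel_fst_symm hx _ (1, 0)]
  simp

/-- The Weingarten equation: `∇_v ∂_r` is dual to minus the second fundamental form. It is what
converts the cross terms of the curvature into products of second fundamental forms. -/
lemma apply_christoffel_normal (hG : IsCylindricalOn G U) (hx : x ∈ U) (v w : ℝ × E) :
    G x (christoffel G x v (1, 0)) w = -(christoffel G x v w).1 := by
  have h := two_mul_christoffel_apply (hG.pos x hx) v (1, 0) w
  rw [hG.fderiv_normal hx, hG.fderiv_symm hx w, hG.fderiv_normal hx] at h
  have := hG.christoffel_fst hx v w
  linarith

end IsCylindricalOn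

end Cylindrical

/-! ### Connection and curvature of `dr² + g_r + g'_r`. -/

section ProductForm

variable (E₁ E₂ : Type*) [NormedAddCommGroup E₁] [NormedSpace ℝ E₁]
  [NormedAddCommGroup E₂] [NormedSpace ℝ E₂]

/-- The projection `(r, x, y) ↦ (r, x)`. -/
def projLeft : ℝ × E₁ × E₂ →L[ℝ] ℝ × E₁ :=
  (ContinuousLinearMap.id ℝ ℝ).prodMap (ContinuousLinearMap.fst ℝ E₁ E₂)

/-- The projection `(r, x, y) ↦ (r, y)`. -/
def projRight : ℝ × E₁ × E₂ →L[ℝ] ℝ × E₂ :=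
  (ContinuousLinearMap.id ℝ ℝ).prodMap (ContinuousLinearMap.snd ℝ E₁ E₂)

/-- The inclusion `(r, x) ↦ (r, x, 0)`. -/
def inclLeft : ℝ × E₁ →L[ℝ] ℝ × E₁ × E₂ :=
  (ContinuousLinearMap.id ℝ ℝ).prodMap (ContinuousLinearMap.inl ℝ E₁ E₂)

/-- The inclusion `(r, y) ↦ (r, 0, y)`. -/
def inclRight : ℝ × E₂ →L[ℝ] ℝ × E₁ × E₂ :=
  (ContinuousLinearMap.id ℝ ℝ).prodMap (ContinuousLinearMap.inr ℝ E₁ E₂)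

variable {E₁ E₂}

@[simp] lemma projLeft_apply (z : ℝ × E₁ × E₂) : projLeft E₁ E₂ z = (z.1, z.2.1) := rfl

@[simp] lemma projRight_apply (z : ℝ × E₁ × E₂) : projRight E₁ E₂ z = (z.1, z.2.2) := rfl

@[simp] lemma inclLeft_apply (z : ℝ × E₁) : inclLeft E₁ E₂ z = (z.1, z.2, 0) := rfl

@[simp] lemma inclRight_apply (z : ℝ × E₂) : inclRight E₁ E₂ z = (z.1, 0, z.2) := rfl

/-- The metric `dr² + g_r + g'_r` built from `G = dr² + g_r` and `G' = dr² + g'_r`. -/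
def sumForm (G₁ : ℝ × E₁ → (ℝ × E₁) →L[ℝ] (ℝ × E₁) →L[ℝ] ℝ)
    (G₂ : ℝ × E₂ → (ℝ × E₂) →L[ℝ] (ℝ × E₂) →L[ℝ] ℝ) (z : ℝ × E₁ × E₂) :
    (ℝ × E₁ × E₂) →L[ℝ] (ℝ × E₁ × E₂) →L[ℝ] ℝ :=
  (ContinuousLinearMap.precomp ℝ (projLeft E₁ E₂)).comp
      ((G₁ (projLeft E₁ E₂ z)).comp (projLeft E₁ E₂))
    + (ContinuousLinearMap.precomp ℝ (projRight E₁ E₂)).comp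
      ((G₂ (projRight E₁ E₂ z)).comp (projRight E₁ E₂))
    - (ContinuousLinearMap.precomp ℝ (ContinuousLinearMap.fst ℝ ℝ (E₁ × E₂))).comp
      ((ContinuousLinearMap.mul ℝ ℝ).comp (ContinuousLinearMap.fst ℝ ℝ (E₁ × E₂)))

variable {G₁ : ℝ × E₁ → (ℝ × E₁) →L[ℝ] (ℝ × E₁) →L[ℝ] ℝ}
  {G₂ : ℝ × E₂ → (ℝ × E₂) →L[ℝ] (ℝ × E₂) →L[ℝ] ℝ}

lemma sumForm_apply (z v w : ℝ × E₁ × E₂) :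
    sumForm G₁ G₂ z v w = G₁ (projLeft E₁ E₂ z) (projLeft E₁ E₂ v) (projLeft E₁ E₂ w)
      + G₂ (projRight E₁ E₂ z) (projRight E₁ E₂ v) (projRight E₁ E₂ w) - v.1 * w.1 := rfl

variable {U₁ : Set (ℝ × E₁)} {U₂ : Set (ℝ × E₂)} {z : ℝ × E₁ × E₂}

lemma sumForm_differentiableAt (hG₁ : DifferentiableAt ℝ G₁ (projLeft E₁ E₂ z))
    (hG₂ : DifferentiableAt ℝ G₂ (projRight E₁ E₂ z)) :
    DifferentiableAt ℝ (sumForm G₁ G₂) z := by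
  have h₁ : DifferentiableAt ℝ (fun z => G₁ (projLeft E₁ E₂ z)) z :=
    hG₁.comp z (projLeft E₁ E₂).differentiableAt
  have h₂ : DifferentiableAt ℝ (fun z => G₂ (projRight E₁ E₂ z)) z :=
    hG₂.comp z (projRight E₁ E₂).differentiableAt
  exact (((differentiableAt_const _).clm_comp (h₁.clm_comp (differentiableAt_const _))).add
    ((differentiableAt_const _).clm_comp (h₂.clm_comp (differentiableAt_const _)))).sub
    (differentiableAt_const _)

lemma fderiv_sumForm (hG₁ : DifferentiableAt ℝ G₁ (projLeft E₁ E₂ z))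
    (hG₂ : DifferentiableAt ℝ G₂ (projRight E₁ E₂ z)) (u v w : ℝ × E₁ × E₂) :
    fderiv ℝ (sumForm G₁ G₂) z u v w =
      fderiv ℝ G₁ (projLeft E₁ E₂ z) (projLeft E₁ E₂ u) (projLeft E₁ E₂ v) (projLeft E₁ E₂ w)
      + fderiv ℝ G₂ (projRight E₁ E₂ z) (projRight E₁ E₂ u) (projRight E₁ E₂ v)
        (projRight E₁ E₂ w) := by
  rw [fderiv_apply_apply (sumForm_differentiableAt hG₁ hG₂)]
  simp only [sumForm_apply]
  have h₁ := ((hG₁.hasFDerivAt.comp z (projLeft E₁ E₂).hasFDerivAt).clm_apply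
    (hasFDerivAt_const (projLeft E₁ E₂ v) z)).clm_apply (hasFDerivAt_const (projLeft E₁ E₂ w) z)
  have h₂ := ((hG₂.hasFDerivAt.comp z (projRight E₁ E₂).hasFDerivAt).clm_apply
    (hasFDerivAt_const (projRight E₁ E₂ v) z)).clm_apply (hasFDerivAt_const (projRight E₁ E₂ w) z)
  have h := (h₁.add h₂).sub_const (v.1 * w.1)
  refine (congrArg (fun L => L u) h.fderiv).trans ?_
  simp

/-- Each inclusion also feeds its `∂_r`-component into the other metric; these surplus terms add up
to `dr²`, which `sumForm` subtracts. -/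
lemma sumForm_incl (hG₁ : IsCylindricalOn G₁ U₁) (hG₂ : IsCylindricalOn G₂ U₂)
    (h₁ : projLeft E₁ E₂ z ∈ U₁) (h₂ : projRight E₁ E₂ z ∈ U₂) (c₁ : ℝ × E₁) (c₂ : ℝ × E₂)
    (w : ℝ × E₁ × E₂) :
    sumForm G₁ G₂ z (inclLeft E₁ E₂ c₁ + inclRight E₁ E₂ c₂) w =
      G₁ (projLeft E₁ E₂ z) c₁ (projLeft E₁ E₂ w)
        + G₂ (projRight E₁ E₂ z) c₂ (projRight E₁ E₂ w) := by
  have e₁ : projLeft E₁ E₂ (inclLeft E₁ E₂ c₁ + inclRight E₁ E₂ c₂) =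
      c₁ + c₂.1 • ((1 : ℝ), (0 : E₁)) := by ext <;> simp
  have e₂ : projRight E₁ E₂ (inclLeft E₁ E₂ c₁ + inclRight E₁ E₂ c₂) =
      c₂ + c₁.1 • ((1 : ℝ), (0 : E₂)) := by ext <;> simp [add_comm]
  rw [sumForm_apply, e₁, e₂]
  simp only [map_add, map_smul, add_apply, smul_apply, hG₁.normal _ h₁,
    hG₂.normal _ h₂]
  simp
  ring

lemma sumForm_pos (hG₁ : IsCylindricalOn G₁ U₁) (hG₂ : IsCylindricalOn G₂ U₂)
    (h₁ : projLeft E₁ E₂ z ∈ U₁) (h₂ : projRight E₁ E₂ z ∈ U₂) (v : ℝ × E₁ × E₂) (hv : v ≠ 0) :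
    0 < sumForm G₁ G₂ z v v := by
  -- The whole `∂_r`-component is assigned to the left factor, so that the form becomes a sum of two
  -- nonnegative terms.
  have e : v = inclLeft E₁ E₂ (projLeft E₁ E₂ v) + inclRight E₁ E₂ (0, v.2.2) := by
    ext <;> simp
  have e₂ : projRight E₁ E₂ v = (0, v.2.2) + v.1 • ((1 : ℝ), (0 : E₂)) := by ext <;> simp
  have key : sumForm G₁ G₂ z v v =
      G₁ (projLeft E₁ E₂ z) (projLeft E₁ E₂ v) (projLeft E₁ E₂ v)
      + G₂ (projRight E₁ E₂ z) (0, v.2.2) (0, v.2.2) := by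
    have h := sumForm_incl hG₁ hG₂ h₁ h₂ (projLeft E₁ E₂ v) (0, v.2.2) v
    rw [← e] at h
    rw [h, e₂, map_add, map_smul, hG₂.symm _ h₂ _ (1, 0), hG₂.normal _ h₂]
    simp
  rw [key]
  by_cases hv₁ : projLeft E₁ E₂ v = 0
  · have : ((0 : ℝ), v.2.2) ≠ 0 := by
      rintro h
      refine hv ?_
      rw [e, hv₁, h]
      simp only [map_zero, add_zero]
    simpa [hv₁] using hG₂.pos _ h₂ _ this
  · have h := hG₁.pos _ h₁ _ hv₁
    by_cases hv₂ : ((0 : ℝ), v.2.2) = 0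
    · rw [hv₂]; simpa using h
    · exact add_pos h (hG₂.pos _ h₂ _ hv₂)

variable [FiniteDimensional ℝ E₁] [FiniteDimensional ℝ E₂]

/-- The subtracted `dr²` has constant coefficients, so the right-hand side of the Koszul formula is
additive; `sumForm_incl` makes the left-hand side additive too. -/
lemma christoffel_sumForm (hG₁ : IsCylindricalOn G₁ U₁) (hG₂ : IsCylindricalOn G₂ U₂)
    (h₁ : projLeft E₁ E₂ z ∈ U₁) (h₂ : projRight E₁ E₂ z ∈ U₂) (v w : ℝ × E₁ × E₂) :
    christoffel (sumForm G₁ G₂) z v w =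
      inclLeft E₁ E₂
          (christoffel G₁ (projLeft E₁ E₂ z) (projLeft E₁ E₂ v) (projLeft E₁ E₂ w))
        + inclRight E₁ E₂
          (christoffel G₂ (projRight E₁ E₂ z) (projRight E₁ E₂ v) (projRight E₁ E₂ w)) := by
  symm
  refine eq_christoffel (sumForm_pos hG₁ hG₂ h₁ h₂) fun u => ?_
  rw [sumForm_incl hG₁ hG₂ h₁ h₂]
  simp only [fderiv_sumForm (hG₁.differentiableAt h₁) (hG₂.differentiableAt h₂)]
  rw [mul_add, two_mul_christoffel_apply (hG₁.pos _ h₁),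
    two_mul_christoffel_apply (hG₂.pos _ h₂)]
  ring

lemma fderiv_christoffel_sumForm (hG₁ : IsCylindricalOn G₁ U₁) (hG₂ : IsCylindricalOn G₂ U₂)
    (h₁ : projLeft E₁ E₂ z ∈ U₁) (h₂ : projRight E₁ E₂ z ∈ U₂) (u v w : ℝ × E₁ × E₂) :
    fderiv ℝ (fun x => christoffel (sumForm G₁ G₂) x v w) z u =
      inclLeft E₁ E₂
          (fderiv ℝ (fun x => christoffel G₁ x (projLeft E₁ E₂ v) (projLeft E₁ E₂ w))
            (projLeft E₁ E₂ z) (projLeft E₁ E₂ u))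
        + inclRight E₁ E₂
          (fderiv ℝ (fun x => christoffel G₂ x (projRight E₁ E₂ v) (projRight E₁ E₂ w))
            (projRight E₁ E₂ z) (projRight E₁ E₂ u)) := by
  have hev : (fun x => christoffel (sumForm G₁ G₂) x v w) =ᶠ[nhds z] fun x =>
      inclLeft E₁ E₂ (christoffel G₁ (projLeft E₁ E₂ x) (projLeft E₁ E₂ v) (projLeft E₁ E₂ w))
        + inclRight E₁ E₂
          (christoffel G₂ (projRight E₁ E₂ x) (projRight E₁ E₂ v) (projRight E₁ E₂ w)) := by
    filter_upwards [(projLeft E₁ E₂).continuous.continuousAt (hG₁.isOpen.mem_nhds h₁),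
      (projRight E₁ E₂).continuous.continuousAt (hG₂.isOpen.mem_nhds h₂)] with x hx₁ hx₂
    exact christoffel_sumForm hG₁ hG₂ hx₁ hx₂ v w
  rw [hev.fderiv_eq]
  have d₁ := (inclLeft E₁ E₂).hasFDerivAt.comp z ((differentiableAt_christoffel (hG₁.pos _ h₁)
    (hG₁.contDiffAt h₁) (projLeft E₁ E₂ v) (projLeft E₁ E₂ w)).hasFDerivAt.comp z
    (projLeft E₁ E₂).hasFDerivAt)
  have d₂ := (inclRight E₁ E₂).hasFDerivAt.comp z ((differentiableAt_christoffel (hG₂.pos _ h₂)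
    (hG₂.contDiffAt h₂) (projRight E₁ E₂ v) (projRight E₁ E₂ w)).hasFDerivAt.comp z
    (projRight E₁ E₂).hasFDerivAt)
  exact congrArg (fun L => L u) (d₁.add d₂).fderiv

/-- The Gauss equation for `dr² + g_r + g'_r`: besides the curvatures of `dr² + g_r` and
`dr² + g'_r`, only the second fundamental forms of the slices contribute. -/
lemma sumForm_riemann (hG₁ : IsCylindricalOn G₁ U₁) (hG₂ : IsCylindricalOn G₂ U₂)
    (h₁ : projLeft E₁ E₂ z ∈ U₁) (h₂ : projRight E₁ E₂ z ∈ U₂) (u v : ℝ × E₁ × E₂) :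
    sumForm G₁ G₂ z (riemann (sumForm G₁ G₂) z u v v) u =
      G₁ (projLeft E₁ E₂ z) (riemann G₁ (projLeft E₁ E₂ z) (projLeft E₁ E₂ u)
          (projLeft E₁ E₂ v) (projLeft E₁ E₂ v)) (projLeft E₁ E₂ u)
      + G₂ (projRight E₁ E₂ z) (riemann G₂ (projRight E₁ E₂ z) (projRight E₁ E₂ u)
          (projRight E₁ E₂ v) (projRight E₁ E₂ v)) (projRight E₁ E₂ u)
      - ((christoffel G₁ (projLeft E₁ E₂ z) (projLeft E₁ E₂ u) (projLeft E₁ E₂ u)).1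
          * (christoffel G₂ (projRight E₁ E₂ z) (projRight E₁ E₂ v) (projRight E₁ E₂ v)).1
        + (christoffel G₁ (projLeft E₁ E₂ z) (projLeft E₁ E₂ v) (projLeft E₁ E₂ v)).1
          * (christoffel G₂ (projRight E₁ E₂ z) (projRight E₁ E₂ u) (projRight E₁ E₂ u)).1
        - 2 * (christoffel G₁ (projLeft E₁ E₂ z) (projLeft E₁ E₂ u) (projLeft E₁ E₂ v)).1
          * (christoffel G₂ (projRight E₁ E₂ z) (projRight E₁ E₂ u) (projRight E₁ E₂ v)).1) := by
  have e₁ (c₁ : ℝ × E₁) (c₂ : ℝ × E₂) :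
      projLeft E₁ E₂ (inclLeft E₁ E₂ c₁ + inclRight E₁ E₂ c₂) =
      c₁ + c₂.1 • ((1 : ℝ), (0 : E₁)) := by ext <;> simp
  have e₂ (c₁ : ℝ × E₁) (c₂ : ℝ × E₂) :
      projRight E₁ E₂ (inclLeft E₁ E₂ c₁ + inclRight E₁ E₂ c₂) =
      c₂ + c₁.1 • ((1 : ℝ), (0 : E₂)) := by ext <;> simp [add_comm]
  -- Projecting a Christoffel symbol of the sum back to one factor adds the `∂_r`-component of the
  -- other factor's symbol. Applying `Γ` a second time thus yields, besides each factor's own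
  -- curvature, multiples of `Γ(·, ∂_r)`.
  have hR : riemann (sumForm G₁ G₂) z u v v =
      inclLeft E₁ E₂ (riemann G₁ (projLeft E₁ E₂ z) (projLeft E₁ E₂ u)
          (projLeft E₁ E₂ v) (projLeft E₁ E₂ v)
        + (christoffel G₂ (projRight E₁ E₂ z) (projRight E₁ E₂ v) (projRight E₁ E₂ v)).1 •
          christoffel G₁ (projLeft E₁ E₂ z) (projLeft E₁ E₂ u) (1, 0)
        - (christoffel G₂ (projRight E₁ E₂ z) (projRight E₁ E₂ u) (projRight E₁ E₂ v)).1 •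
          christoffel G₁ (projLeft E₁ E₂ z) (projLeft E₁ E₂ v) (1, 0))
      + inclRight E₁ E₂ (riemann G₂ (projRight E₁ E₂ z) (projRight E₁ E₂ u)
          (projRight E₁ E₂ v) (projRight E₁ E₂ v)
        + (christoffel G₁ (projLeft E₁ E₂ z) (projLeft E₁ E₂ v) (projLeft E₁ E₂ v)).1 •
          christoffel G₂ (projRight E₁ E₂ z) (projRight E₁ E₂ u) (1, 0)
        - (christoffel G₁ (projLeft E₁ E₂ z) (projLeft E₁ E₂ u) (projLeft E₁ E₂ v)).1 •
          christoffel G₂ (projRight E₁ E₂ z) (projRight E₁ E₂ v) (1, 0)) := by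
    unfold riemann
    rw [fderiv_christoffel_sumForm hG₁ hG₂ h₁ h₂, fderiv_christoffel_sumForm hG₁ hG₂ h₁ h₂,
      christoffel_sumForm hG₁ hG₂ h₁ h₂ v v, christoffel_sumForm hG₁ hG₂ h₁ h₂ u v,
      christoffel_sumForm hG₁ hG₂ h₁ h₂ u, christoffel_sumForm hG₁ hG₂ h₁ h₂ v]
    simp only [e₁, e₂, christoffel_add_right, christoffel_smul_right, map_add, map_sub]
    abel
  rw [hR, sumForm_incl hG₁ hG₂ h₁ h₂]
  simp only [map_add, map_sub, map_smul, add_apply, sub_apply, smul_apply, smul_eq_mul,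
    hG₁.apply_christoffel_normal h₁, hG₂.apply_christoffel_normal h₂,
    hG₁.christoffel_fst_symm h₁ (projLeft E₁ E₂ v) (projLeft E₁ E₂ u),
    hG₂.christoffel_fst_symm h₂ (projRight E₁ E₂ v) (projRight E₁ E₂ u)]
  ring

end ProductForm

/-! ### Positivity of the tensor product of two symmetric forms. -/

section MixedForm

variable {E₁ E₂ : Type*} [AddCommGroup E₁] [Module ℝ E₁] [AddCommGroup E₂] [Module ℝ E₂]

/-- The value of `P ⊗ S` on `x ⊗ y' - x' ⊗ y`, for symmetric forms `P` and `S`. -/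
def mixedForm (P : LinearMap.BilinForm ℝ E₁) (S : LinearMap.BilinForm ℝ E₂) (x x' : E₁)
    (y y' : E₂) : ℝ :=
  P x x * S y' y' + P x' x' * S y y - 2 * P x x' * S y y'

variable {P g : LinearMap.BilinForm ℝ E₁} {S h : LinearMap.BilinForm ℝ E₂}

lemma mixedForm_nonneg (hP : ∀ x, 0 ≤ P x x) (hP' : ∀ x y, P x y = P y x)
    (hS : ∀ x, 0 ≤ S x x) (hS' : ∀ x y, S x y = S y x) (x x' : E₁) (y y' : E₂) :
    0 ≤ mixedForm P S x x' y y' := by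
  have h₁ : P x x' ^ 2 ≤ P x x * P x' x' := by
    have := LinearMap.BilinForm.apply_mul_apply_le_of_forall_zero_le P hP x x'
    rwa [hP' x' x, ← sq] at this
  have h₂ : S y y' ^ 2 ≤ S y y * S y' y' := by
    have := LinearMap.BilinForm.apply_mul_apply_le_of_forall_zero_le S hS y y'
    rwa [hS' y' y, ← sq] at this
  -- Multiply the two Cauchy–Schwarz inequalities and apply `4ab ≤ (a + b)²`.
  have h₃ : (2 * (P x x' * S y y')) ^ 2 ≤ (P x x * S y' y' + P x' x' * S y y) ^ 2 := by
    have := mul_le_mul h₁ h₂ (sq_nonneg _) (mul_nonneg (hP x) (hP x'))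
    nlinarith [sq_nonneg (P x x * S y' y' - P x' x' * S y y)]
  have h₄ := abs_le_of_sq_le_sq h₃
    (add_nonneg (mul_nonneg (hP x) (hS y')) (mul_nonneg (hP x') (hS y)))
  rw [mixedForm]
  linarith [le_of_abs_le h₄]

/-- `C² g ⊗ h - P ⊗ S = P ⊗ (C h - S) + (C g - P) ⊗ C h`, and both summands are tensor products of
nonnegative forms. -/
lemma mixedForm_le (hP : ∀ x, 0 ≤ P x x) (hP' : ∀ x y, P x y = P y x)
    (hS' : ∀ x y, S x y = S y x)
    (hg' : ∀ x y, g x y = g y x)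
    (hh : ∀ x, 0 ≤ h x x) (hh' : ∀ x y, h x y = h y x) {C : ℝ} (hC : 0 ≤ C)
    (hPC : ∀ x, P x x ≤ C * g x x) (hSC : ∀ x, S x x ≤ C * h x x) (x x' : E₁) (y y' : E₂) :
    mixedForm P S x x' y y' ≤ C ^ 2 * mixedForm g h x x' y y' := by
  have h₁ := mixedForm_nonneg (P := P) (S := C • h - S) hP hP'
    (fun x => by simpa using hSC x) (fun x y => by simp [hS' x y, hh' x y]) x x' y y'
  have h₂ := mixedForm_nonneg (P := C • g - P) (S := C • h)
    (fun x => by simpa using hPC x) (fun x y => by simp [hP' x y, hg' x y])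
    (fun x => by simpa using mul_nonneg hC (hh x)) (fun x y => by simp [hh' x y]) x x' y y'
  simp only [mixedForm, LinearMap.sub_apply, LinearMap.smul_apply, smul_eq_mul] at h₁ h₂ ⊢
  linarith

lemma exists_smul_of_not_linearIndependent {V : Type*} [AddCommGroup V] [Module ℝ V] {u v : V}
    (h : ¬ LinearIndependent ℝ ![u, v]) : ∃ (e : V) (a b : ℝ), u = a • e ∧ v = b • e := by
  rw [LinearIndependent.pair_iff] at h
  push Not at h
  obtain ⟨s, t, hst, hne⟩ := h
  by_cases hs : s = 0
  · have ht : t ≠ 0 := hne hs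
    refine ⟨u, 1, 0, by simp, ?_⟩
    simpa [hs, ht] using hst
  · refine ⟨v, -(s⁻¹ * t), 1, ?_, by simp⟩
    have h1 := congrArg (fun w => s⁻¹ • w) hst
    simp only [smul_add, smul_smul, inv_mul_cancel₀ hs, one_smul, smul_zero] at h1
    rw [neg_smul, eq_neg_iff_add_eq_zero, h1]

/-- Both projected pairs lie on lines, so the tangential parts are `αe, βe` and `γf, δf`, and the
mixed form is `P(e, e) S(f, f) (αδ - βγ)²`. If one of these factors vanished, `u` and `v` would be
dependent. -/
lemma mixedForm_pos (hP : ∀ x, x ≠ 0 → 0 < P x x) (hS : ∀ x, x ≠ 0 → 0 < S x x)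
    {u v : ℝ × E₁ × E₂} (huv : LinearIndependent ℝ ![u, v])
    (h₁ : ¬ LinearIndependent ℝ ![(u.1, u.2.1), (v.1, v.2.1)])
    (h₂ : ¬ LinearIndependent ℝ ![(u.1, u.2.2), (v.1, v.2.2)]) :
    0 < mixedForm P S u.2.1 v.2.1 u.2.2 v.2.2 := by
  obtain ⟨a, x, y⟩ := u
  obtain ⟨b, x', y'⟩ := v
  obtain ⟨⟨c, e⟩, α, β, hu₁, hv₁⟩ := exists_smul_of_not_linearIndependent h₁
  obtain ⟨⟨d, f⟩, γ, δ, hu₂, hv₂⟩ := exists_smul_of_not_linearIndependent h₂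
  simp only [Prod.smul_mk, Prod.mk.injEq, smul_eq_mul] at hu₁ hv₁ hu₂ hv₂ ⊢
  obtain ⟨ha, rfl⟩ := hu₁
  obtain ⟨hb, rfl⟩ := hv₁
  obtain ⟨ha', rfl⟩ := hu₂
  obtain ⟨hb', rfl⟩ := hv₂
  rw [LinearIndependent.pair_iff] at huv
  have hne : α * δ - β * γ ≠ 0 := by
    intro h0
    have hs (s t : ℝ) (h1 : s * α + t * β = 0) (h2 : s * γ + t * δ = 0) : s = 0 ∧ t = 0 := by
      refine huv s t ?_
      simp only [Prod.smul_mk, Prod.mk_add_mk, smul_smul, ← add_smul, h1, h2, zero_smul]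
      ext <;> simp
      rw [ha, hb]
      linear_combination c * h1
    have h3 := hs δ (-γ) (by linarith) (by ring)
    have h4 := hs β (-α) (by ring) (by linarith)
    have h5 := hs 1 0 (by simp; linarith) (by simp; linarith)
    exact one_ne_zero h5.1
  have hs (s t : ℝ) (h0 : s * a + t * b = 0) (h1 : (s * α + t * β) • e = 0)
      (h2 : (s * γ + t * δ) • f = 0) : s = 0 ∧ t = 0 := by
    refine huv s t ?_
    simp only [Prod.smul_mk, Prod.mk_add_mk, smul_smul, ← add_smul, h1, h2, smul_eq_mul, h0]
    rfl
  have he : e ≠ 0 := by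
    rintro rfl
    -- With `e = 0`, the combination `δu - γv` vanishes: its `f`-part cancels, and so does its
    -- `∂_r`-part, which is `d` times the same expression.
    have h3 := hs δ (-γ) (by rw [ha', hb']; ring) (by simp) (by ring_nf; simp)
    exact hne (by rw [h3.1, neg_eq_zero.1 h3.2]; ring)
  have hf : f ≠ 0 := by
    rintro rfl
    have h3 := hs β (-α) (by rw [ha, hb]; ring) (by ring_nf; simp) (by simp)
    exact hne (by rw [h3.1, neg_eq_zero.1 h3.2]; ring)
  have key : mixedForm P S (α • e) (β • e) (γ • f) (δ • f) =
      P e e * S f f * (α * δ - β * γ) ^ 2 := by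
    simp [mixedForm]
    ring
  rw [key]
  exact mul_pos (mul_pos (hP e he) (hS f hf)) (by positivity)

end MixedForm

/-! ### Riemannian metrics read in preferred charts. -/

section Charts

variable {E : Type*} [NormedAddCommGroup E] [NormedSpace ℝ E]
  {H : Type*} [TopologicalSpace H] {I : ModelWithCorners ℝ E H}
  {M : Type*} [TopologicalSpace M] [ChartedSpace H M]

lemma inChart_apply (g : FormField I M) (x₀ : M) (y v w : E) :
    inChart g x₀ y v w = g ((extChartAt I x₀).symm y)
      (mfderiv 𝓘(ℝ, E) I (extChartAt I x₀).symm y v)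
      (mfderiv 𝓘(ℝ, E) I (extChartAt I x₀).symm y w) := rfl

variable [IsManifold I ∞ M]

lemma coords_eq (p : M) (v : E) : coords (I := I) p v = v := by
  have : IsManifold I 1 M := .of_le (n := ∞) (by norm_cast)
  exact congrArg (fun L : E →L[ℝ] E => L v) (mfderiv_extChartAt_self (I := I) (x := p))

lemma inChart_self [I.Boundaryless] (g : FormField I M) (p : M) (v w : TangentSpace I p) :
    inChart g p (extChartAt I p p) v w = g p v w := by
  have : IsManifold I 1 M := .of_le (n := ∞) (by norm_cast)
  -- The base point after the chart round trip equals `p` only propositionally, and `g` is dependent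
  -- on it; generalizing point and derivative together permits substitution.
  have h (q : M) (hq : q = p) (D : E →L[ℝ] E) (hD : D = ContinuousLinearMap.id ℝ E) :
      (g q : E →L[ℝ] E →L[ℝ] ℝ) (D v) (D w) = g p v w := by
    subst hq hD
    rfl
  refine h _ (extChartAt_to_inv p) _ ?_
  have := mfderivWithin_range_extChartAt_symm (I := I) (x := p)
  rwa [I.range_eq_univ, mfderivWithin_univ] at this

lemma sectionalCurvature_eq (g : FormField I M) (p : M) (u v : E) :
    sectionalCurvature g p u v =
      inChart g p (extChartAt I p p)
          (riemann (inChart g p) (extChartAt I p p) u v v) u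
        / ((g p : E →L[ℝ] E →L[ℝ] ℝ) u u * (g p : E →L[ℝ] E →L[ℝ] ℝ) v v
          - (g p : E →L[ℝ] E →L[ℝ] ℝ) u v ^ 2) := by
  simp only [sectionalCurvature, coords_eq]

lemma mdifferentiableAt_extChartAt_symm' [I.Boundaryless] {x₀ : M} {y : E} (hy : y ∈ (extChartAt I x₀).target) :
    MDifferentiableAt 𝓘(ℝ, E) I (extChartAt I x₀).symm y := by
  have : IsManifold I 1 M := .of_le (n := ∞) (by norm_cast)
  have := mdifferentiableWithinAt_extChartAt_symm (I := I) hy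
  rwa [I.range_eq_univ, mdifferentiableWithinAt_univ] at this

lemma mfderiv_extChartAt_symm_injective [I.Boundaryless] {x₀ : M} {y : E} (hy : y ∈ (extChartAt I x₀).target) :
    Function.Injective (mfderiv 𝓘(ℝ, E) I (extChartAt I x₀).symm y) := by
  have : IsManifold I 1 M := .of_le (n := ∞) (by norm_cast)
  have h := mfderiv_extChartAt_comp_mfderivWithin_extChartAt_symm (I := I) hy
  rw [I.range_eq_univ, mfderivWithin_univ] at h
  intro v w hvw
  have hv := congrArg (fun L => L v) h
  have hw := congrArg (fun L => L w) h
  simp only [ContinuousLinearMap.comp_apply] at hv hw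
  rw [hvw] at hv
  exact (hv.symm.trans hw)

namespace IsRiemannianMetric

variable {g : FormField I M}

lemma symm (hg : IsRiemannianMetric g) (p : M) (v w : TangentSpace I p) : g p v w = g p w v := by
  obtain ⟨m, rfl⟩ := hg
  exact m.symm p v w

lemma pos (hg : IsRiemannianMetric g) (p : M) (v : TangentSpace I p) (hv : v ≠ 0) :
    0 < g p v v := by
  obtain ⟨m, rfl⟩ := hg
  exact m.pos p v hv

lemma inChart_symm (hg : IsRiemannianMetric g) (x₀ : M) (y v w : E) :
    inChart g x₀ y v w = inChart g x₀ y w v := hg.symm _ _ _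

lemma inChart_pos [I.Boundaryless] (hg : IsRiemannianMetric g) {x₀ : M} {y : E}
    (hy : y ∈ (extChartAt I x₀).target) (v : E) (hv : v ≠ 0) : 0 < inChart g x₀ y v v := by
  refine hg.pos _ _ fun h => hv (mfderiv_extChartAt_symm_injective hy ?_)
  exact h.trans (map_zero _).symm

lemma contDiffOn_inChart_apply [I.Boundaryless] (hg : IsRiemannianMetric g) (x₀ : M) (v w : E) :
    ContDiffOn ℝ ∞ (fun y => inChart g x₀ y v w) (extChartAt I x₀).target := by
  obtain ⟨m, rfl⟩ := hg
  have hopen : IsOpen (extChartAt I x₀).target := isOpen_extChartAt_target x₀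
  -- The tangent map of the inverse chart carries constant vectors to smooth fields along it;
  -- evaluating the smooth bundle metric on two such fields gives a coefficient.
  have hT := (contMDiffOn_extChartAt_symm (I := I) (n := ∞) x₀).contMDiffOn_tangentMapWithin
    (m := ∞) (by simp) hopen.uniqueMDiffOn
  have hvec (v : E) : ContMDiffOn 𝓘(ℝ, E) I.tangent ∞
      (fun y => TotalSpace.mk' E (E := fun p : M => TangentSpace I p) ((extChartAt I x₀).symm y)
        (mfderiv 𝓘(ℝ, E) I (extChartAt I x₀).symm y v)) (extChartAt I x₀).target := by
    have hsec : ContMDiffOn 𝓘(ℝ, E) 𝓘(ℝ, E).tangent ∞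
        (fun y => TotalSpace.mk' E (E := fun p : E => TangentSpace 𝓘(ℝ, E) p) y v)
        (extChartAt I x₀).target := by
      intro y _
      rw [contMDiffWithinAt_totalSpace]
      exact ⟨contMDiffWithinAt_id, by simpa using contMDiffWithinAt_const⟩
    refine (hT.comp hsec fun y hy => hy).congr fun y hy => ?_
    simp only [Function.comp, tangentMapWithin]
    rw [mfderivWithin_of_isOpen hopen hy]
  have h : ContMDiffOn 𝓘(ℝ, E) (I.prod 𝓘(ℝ)) ∞
      (fun y => TotalSpace.mk' ℝ (E := Bundle.Trivial M ℝ) ((extChartAt I x₀).symm y)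
        (inChart m.inner x₀ y v w)) (extChartAt I x₀).target := by
    intro y hy
    apply ContMDiffWithinAt.clm_bundle_apply₂ (F₁ := E) (F₂ := E)
    · exact ContMDiffAt.comp_contMDiffWithinAt y m.contMDiff.contMDiffAt
        (contMDiffOn_extChartAt_symm (I := I) (n := ∞) x₀ y hy)
    · exact hvec v y hy
    · exact hvec w y hy
  intro y hy
  have := h y hy
  rw [contMDiffWithinAt_totalSpace] at this
  exact this.2.contDiffWithinAt

variable [FiniteDimensional ℝ E]

lemma contDiffOn_inChart [I.Boundaryless] (hg : IsRiemannianMetric g) (x₀ : M) :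
    ContDiffOn ℝ ∞ (inChart g x₀) (extChartAt I x₀).target :=
  contDiffOn_clm_apply.2 fun v => contDiffOn_clm_apply.2 fun w =>
    hg.contDiffOn_inChart_apply x₀ v w

end IsRiemannianMetric

end Charts

/-! ### Preferred charts of products and cylinders. -/

section ProductCharts

variable {E : Type*} [NormedAddCommGroup E] [NormedSpace ℝ E]
  {H : Type*} [TopologicalSpace H] {I : ModelWithCorners ℝ E H}
  {B : Type*} [TopologicalSpace B] [ChartedSpace H B]
  {E' : Type*} [NormedAddCommGroup E'] [NormedSpace ℝ E']
  {H' : Type*} [TopologicalSpace H'] {I' : ModelWithCorners ℝ E' H'}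
  {B' : Type*} [TopologicalSpace B'] [ChartedSpace H' B']

lemma extChartAt_real_symm (r : ℝ) : ((extChartAt 𝓘(ℝ, ℝ) r).symm : ℝ → ℝ) = id := by
  rw [extChartAt_model_space_eq_id]
  rfl

lemma mem_extChartAt_real_target (r s : ℝ) : s ∈ (extChartAt 𝓘(ℝ, ℝ) r).target := by
  rw [extChartAt_model_space_eq_id]
  trivial

lemma mem_target_prod {p : B × B'} {z : E × E'} :
    z ∈ (extChartAt (I.prod I') p).target ↔
      z.1 ∈ (extChartAt I p.1).target ∧ z.2 ∈ (extChartAt I' p.2).target := by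
  rw [extChartAt_prod]
  exact Set.mem_prod

lemma mem_target_cylinder {p : ℝ × B} {z : ℝ × E} :
    z ∈ (extChartAt (𝓘(ℝ, ℝ).prod I) p).target ↔ z.2 ∈ (extChartAt I p.2).target :=
  mem_target_prod.trans (and_iff_right (mem_extChartAt_real_target _ _))

lemma extChartAt_symm_prod (p : B × B') (z : E × E') :
    (extChartAt (I.prod I') p).symm z =
      ((extChartAt I p.1).symm z.1, (extChartAt I' p.2).symm z.2) := by
  rw [extChartAt_prod]
  rfl

lemma extChartAt_symm_cylinder (p : ℝ × B) (z : ℝ × E) :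
    (extChartAt (𝓘(ℝ, ℝ).prod I) p).symm z = (z.1, (extChartAt I p.2).symm z.2) := by
  rw [extChartAt_symm_prod, extChartAt_real_symm]
  rfl

variable [I.Boundaryless] [IsManifold I ∞ B] [I'.Boundaryless] [IsManifold I' ∞ B']

lemma inChart_prod (g : FormField (I.prod I') (B × B')) {b : B} {b' : B'} {y : E} {y' : E'}
    (hy : y ∈ (extChartAt I b).target) (hy' : y' ∈ (extChartAt I' b').target) (v w : E × E') :
    inChart g (b, b') (y, y') v w =
      g ((extChartAt I b).symm y, (extChartAt I' b').symm y')
        (mfderiv 𝓘(ℝ, E) I (extChartAt I b).symm y v.1,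
          mfderiv 𝓘(ℝ, E') I' (extChartAt I' b').symm y' v.2)
        (mfderiv 𝓘(ℝ, E) I (extChartAt I b).symm y w.1,
          mfderiv 𝓘(ℝ, E') I' (extChartAt I' b').symm y' w.2) := by
  have h := HasMFDerivAt.prodMap (p := (y, y'))
    (mdifferentiableAt_extChartAt_symm' hy).hasMFDerivAt
    (mdifferentiableAt_extChartAt_symm' hy').hasMFDerivAt
  have hc : ((extChartAt (I.prod I') (b, b')).symm : E × E' → B × B') =
      Prod.map (extChartAt I b).symm (extChartAt I' b').symm := by
    rw [extChartAt_prod]; rfl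
  have h' : HasMFDerivAt 𝓘(ℝ, E × E') (I.prod I') (extChartAt (I.prod I') (b, b')).symm (y, y')
      ((mfderiv 𝓘(ℝ, E) I (extChartAt I b).symm y).prodMap
        (mfderiv 𝓘(ℝ, E') I' (extChartAt I' b').symm y')) := by
    rw [hc, modelWithCornersSelf_prod, ← chartedSpaceSelf_prod]
    exact h
  rw [inChart_apply, h'.mfderiv]
  rfl

lemma inChart_cylinder (g : ℝ → FormField I B) (p : ℝ × B) {z : ℝ × E}
    (hz : z.2 ∈ (extChartAt I p.2).target) (v w : ℝ × E) :
    inChart (cylinder g) p z v w = v.1 * w.1 + inChart (g z.1) p.2 z.2 v.2 w.2 := by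
  obtain ⟨r, b⟩ := p
  obtain ⟨s, y⟩ := z
  have h (q : ℝ) (hq : q = s) (D : ℝ →L[ℝ] ℝ) (hD : D = ContinuousLinearMap.id ℝ ℝ) :
      cylinder g (q, (extChartAt I b).symm y)
        (D v.1, mfderiv 𝓘(ℝ, E) I (extChartAt I b).symm y v.2)
        (D w.1, mfderiv 𝓘(ℝ, E) I (extChartAt I b).symm y w.2) =
      v.1 * w.1 + inChart (g s) b y v.2 w.2 := by
    subst hq hD
    rfl
  rw [inChart_prod (cylinder g) (mem_extChartAt_real_target r s) hz]
  refine h _ ?_ _ ?_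
  · rw [extChartAt_real_symm]; rfl
  · rw [extChartAt_real_symm]; exact mfderiv_id

lemma inChart_prodFamily (g : ℝ → FormField I B) (g' : ℝ → FormField I' B') (r : ℝ) (b : B) (b' : B')
    {y : E} {y' : E'} (hy : y ∈ (extChartAt I b).target) (hy' : y' ∈ (extChartAt I' b').target)
    (v w : E × E') :
    inChart (prodFamily g g' r) (b, b') (y, y') v w =
      inChart (g r) b y v.1 w.1 + inChart (g' r) b' y' v.2 w.2 := by
  rw [inChart_prod (prodFamily g g' r) hy hy']
  rfl

lemma inChart_cylinder_prodFamily (g : ℝ → FormField I B) (g' : ℝ → FormField I' B')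
    (p : ℝ × B × B') {z : ℝ × E × E'}
    (hz : z.2.1 ∈ (extChartAt I p.2.1).target) (hz' : z.2.2 ∈ (extChartAt I' p.2.2).target) :
    inChart (cylinder (prodFamily g g')) p z =
      sumForm (inChart (cylinder g) (p.1, p.2.1)) (inChart (cylinder g') (p.1, p.2.2)) z := by
  refine ContinuousLinearMap.ext fun v => ContinuousLinearMap.ext fun w => ?_
  rw [inChart_cylinder (prodFamily g g') p (by rw [extChartAt_prod]; exact ⟨hz, hz'⟩),
    inChart_prodFamily g g' z.1 p.2.1 p.2.2 hz hz', sumForm_apply,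
    inChart_cylinder g (p.1, p.2.1) (z := projLeft E E' z) hz,
    inChart_cylinder g' (p.1, p.2.2) (z := projRight E E' z) hz']
  simp
  ring

lemma IsMetricFamily.isCylindricalOn [FiniteDimensional ℝ E] {g : ℝ → FormField I B}
    (hg : IsMetricFamily g) (p : ℝ × B) :
    IsCylindricalOn (inChart (cylinder g) p) (extChartAt (𝓘(ℝ, ℝ).prod I) p).target where
  isOpen := isOpen_extChartAt_target p
  contDiffOn := IsRiemannianMetric.contDiffOn_inChart hg p
  symm _ _ v w := IsRiemannianMetric.inChart_symm hg p _ v w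
  pos _ hx v hv := IsRiemannianMetric.inChart_pos hg hx v hv
  normal x hx v := by
    rw [inChart_cylinder g p (mem_target_cylinder.1 hx)]
    simp

end ProductCharts

/-! ### Splitting of curvature and area for `dr² + g_r + g'_r`, and the pointwise estimates. -/

section Curvature

variable {E : Type*} [NormedAddCommGroup E] [NormedSpace ℝ E]

/-- The numerator of the sectional curvature of the plane spanned by `u` and `v`. -/
def curvatureForm (G : E → E →L[ℝ] E →L[ℝ] ℝ) (y u v : E) : ℝ :=
  G y (riemann G y u v v) u

/-- The squared area of the parallelogram spanned by `u` and `v`. -/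
def gram (A : E →L[ℝ] E →L[ℝ] ℝ) (u v : E) : ℝ := A u u * A v v - A u v ^ 2

lemma gram_pos {A : E →L[ℝ] E →L[ℝ] ℝ} (hA : ∀ v, v ≠ 0 → 0 < A v v)
    (hA' : ∀ v w, A v w = A w v) {u v : E} (huv : LinearIndependent ℝ ![u, v]) :
    0 < gram A u v := by
  rw [LinearIndependent.pair_iff] at huv
  have hv : v ≠ 0 := by
    rintro rfl
    simpa using huv 0 1 (by simp)
  have hvv := hA v hv
  have hw := hA (A v v • u - A u v • v) fun h => hvv.ne' <| (huv (A v v) (-A u v) (by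
    rw [neg_smul, ← sub_eq_add_neg, h])).1
  simp only [map_sub, map_smul, sub_apply, smul_apply, smul_eq_mul, hA' v u] at hw
  refine pos_of_mul_pos_right (a := A v v) ?_ hvv.le
  rw [gram]
  linarith

lemma gram_eq_zero {A : E →L[ℝ] E →L[ℝ] ℝ} {u v : E}
    (huv : ¬ LinearIndependent ℝ ![u, v]) : gram A u v = 0 := by
  obtain ⟨e, a, b, rfl, rfl⟩ := exists_smul_of_not_linearIndependent huv
  simp [gram]
  ring

lemma gram_nonneg {A : E →L[ℝ] E →L[ℝ] ℝ} (hA : ∀ v, v ≠ 0 → 0 < A v v)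
    (hA' : ∀ v w, A v w = A w v) (u v : E) : 0 ≤ gram A u v := by
  by_cases h : LinearIndependent ℝ ![u, v]
  · exact (gram_pos hA hA' h).le
  · exact (gram_eq_zero h).ge

lemma curvatureForm_eq_zero (G : E → E →L[ℝ] E →L[ℝ] ℝ) (y : E) {u v : E}
    (huv : ¬ LinearIndependent ℝ ![u, v]) : curvatureForm G y u v = 0 := by
  obtain ⟨e, a, b, rfl, rfl⟩ := exists_smul_of_not_linearIndependent huv
  simp [curvatureForm, riemann_smul_smul]

/-- The negative of the second fundamental form of the slice through `x`. -/
def shapeForm (G : ℝ × E → (ℝ × E) →L[ℝ] (ℝ × E) →L[ℝ] ℝ) (x : ℝ × E) :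
    LinearMap.BilinForm ℝ E :=
  LinearMap.mk₂ ℝ (fun v w => -(christoffel G x (0, v) (0, w)).1)
    (fun v v' w => by
      have : ((0 : ℝ), v + v') = (0, v) + (0, v') := by simp
      rw [this, christoffel_add_left, Prod.fst_add, neg_add])
    (fun c v w => by
      have : ((0 : ℝ), c • v) = c • (0, v) := by simp
      rw [this, christoffel_smul_left, Prod.smul_fst, smul_neg])
    (fun v w w' => by
      have : ((0 : ℝ), w + w') = (0, w) + (0, w') := by simp
      rw [this, christoffel_add_right, Prod.fst_add, neg_add])
    (fun c v w => by
      have : ((0 : ℝ), c • w) = c • (0, w) := by simp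
      rw [this, christoffel_smul_right, Prod.smul_fst, smul_neg])

lemma shapeForm_apply (G : ℝ × E → (ℝ × E) →L[ℝ] (ℝ × E) →L[ℝ] ℝ) (x : ℝ × E) (v w : E) :
    shapeForm G x v w = -(christoffel G x (0, v) (0, w)).1 := rfl

/-- The restriction of `G` to the slice through `x`. -/
def sliceForm (G : ℝ × E → (ℝ × E) →L[ℝ] (ℝ × E) →L[ℝ] ℝ) (x : ℝ × E) :
    LinearMap.BilinForm ℝ E :=
  LinearMap.mk₂ ℝ (fun v w => G x (0, v) (0, w))
    (fun v v' w => by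
      have : ((0 : ℝ), v + v') = (0, v) + (0, v') := by simp
      rw [this, map_add, add_apply])
    (fun c v w => by
      have : ((0 : ℝ), c • v) = c • (0, v) := by simp
      rw [this, map_smul, smul_apply])
    (fun v w w' => by
      have : ((0 : ℝ), w + w') = (0, w) + (0, w') := by simp
      rw [this, map_add])
    (fun c v w => by
      have : ((0 : ℝ), c • w) = c • (0, w) := by simp
      rw [this, map_smul])

lemma sliceForm_apply (G : ℝ × E → (ℝ × E) →L[ℝ] (ℝ × E) →L[ℝ] ℝ) (x : ℝ × E) (v w : E) :
    sliceForm G x v w = G x (0, v) (0, w) := rfl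

namespace IsCylindricalOn

variable {G : ℝ × E → (ℝ × E) →L[ℝ] (ℝ × E) →L[ℝ] ℝ} {U : Set (ℝ × E)} {x : ℝ × E}

lemma apply_eq (hG : IsCylindricalOn G U) (hx : x ∈ U) (v w : ℝ × E) :
    G x v w = v.1 * w.1 + sliceForm G x v.2 w.2 := by
  have h (a : ℝ × E) : a = a.1 • ((1 : ℝ), (0 : E)) + (0, a.2) := by ext <;> simp
  conv_lhs => rw [h v, h w]
  simp only [map_add, map_smul, add_apply, smul_apply, hG.normal x hx, hG.symm x hx _ (1, 0),
    sliceForm_apply]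
  simp [mul_comm]

lemma sliceForm_nonneg (hG : IsCylindricalOn G U) (hx : x ∈ U) (v : E) :
    0 ≤ sliceForm G x v v := by
  rcases eq_or_ne v 0 with rfl | hv
  · simp
  · exact (hG.pos x hx (0, v) (by simp [hv])).le

variable [FiniteDimensional ℝ E]

lemma christoffel_fst_eq_shapeForm (hG : IsCylindricalOn G U) (hx : x ∈ U) (v w : ℝ × E) :
    (christoffel G x v w).1 = -shapeForm G x v.2 w.2 := by
  rw [hG.christoffel_fst_eq hx, shapeForm_apply, neg_neg]

lemma shapeForm_symm (hG : IsCylindricalOn G U) (hx : x ∈ U) (v w : E) :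
    shapeForm G x v w = shapeForm G x w v := by
  rw [shapeForm_apply, hG.christoffel_fst_symm hx, shapeForm_apply]

end IsCylindricalOn

variable {E₁ E₂ : Type*} [NormedAddCommGroup E₁] [NormedSpace ℝ E₁]
  [NormedAddCommGroup E₂] [NormedSpace ℝ E₂]
  {G₁ : ℝ × E₁ → (ℝ × E₁) →L[ℝ] (ℝ × E₁) →L[ℝ] ℝ}
  {G₂ : ℝ × E₂ → (ℝ × E₂) →L[ℝ] (ℝ × E₂) →L[ℝ] ℝ}
  {U₁ : Set (ℝ × E₁)} {U₂ : Set (ℝ × E₂)} {z : ℝ × E₁ × E₂}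

/-- The exact counterpart of `curvatureForm_sumForm`, with slice metrics in place of shape forms;
this parallel makes the bound on the quotient possible. -/
lemma gram_sumForm (hG₁ : IsCylindricalOn G₁ U₁) (hG₂ : IsCylindricalOn G₂ U₂)
    (h₁ : projLeft E₁ E₂ z ∈ U₁) (h₂ : projRight E₁ E₂ z ∈ U₂) (u v : ℝ × E₁ × E₂) :
    gram (sumForm G₁ G₂ z) u v =
      gram (G₁ (projLeft E₁ E₂ z)) (projLeft E₁ E₂ u) (projLeft E₁ E₂ v)
      + gram (G₂ (projRight E₁ E₂ z)) (projRight E₁ E₂ u) (projRight E₁ E₂ v)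
      + mixedForm (sliceForm G₁ (projLeft E₁ E₂ z)) (sliceForm G₂ (projRight E₁ E₂ z))
        u.2.1 v.2.1 u.2.2 v.2.2 := by
  simp only [gram, sumForm_apply, hG₁.apply_eq h₁, hG₂.apply_eq h₂, mixedForm]
  simp only [projLeft_apply, projRight_apply]
  ring

lemma sumForm_symm (hG₁ : IsCylindricalOn G₁ U₁) (hG₂ : IsCylindricalOn G₂ U₂)
    (h₁ : projLeft E₁ E₂ z ∈ U₁) (h₂ : projRight E₁ E₂ z ∈ U₂) (u v : ℝ × E₁ × E₂) :
    sumForm G₁ G₂ z u v = sumForm G₁ G₂ z v u := by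
  rw [sumForm_apply, sumForm_apply, hG₁.symm _ h₁, hG₂.symm _ h₂, mul_comm u.1]

variable [FiniteDimensional ℝ E₁] [FiniteDimensional ℝ E₂]

lemma curvatureForm_sumForm (hG₁ : IsCylindricalOn G₁ U₁) (hG₂ : IsCylindricalOn G₂ U₂)
    (h₁ : projLeft E₁ E₂ z ∈ U₁) (h₂ : projRight E₁ E₂ z ∈ U₂) (u v : ℝ × E₁ × E₂) :
    curvatureForm (sumForm G₁ G₂) z u v =
      curvatureForm G₁ (projLeft E₁ E₂ z) (projLeft E₁ E₂ u) (projLeft E₁ E₂ v)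
      + curvatureForm G₂ (projRight E₁ E₂ z) (projRight E₁ E₂ u) (projRight E₁ E₂ v)
      - mixedForm (shapeForm G₁ (projLeft E₁ E₂ z)) (shapeForm G₂ (projRight E₁ E₂ z))
        u.2.1 v.2.1 u.2.2 v.2.2 := by
  rw [curvatureForm, sumForm_riemann hG₁ hG₂ h₁ h₂]
  simp only [hG₁.christoffel_fst_eq_shapeForm h₁, hG₂.christoffel_fst_eq_shapeForm h₂,
    curvatureForm, mixedForm]
  simp only [projLeft_apply, projRight_apply]
  ring

lemma curvatureForm_sumForm_neg (hG₁ : IsCylindricalOn G₁ U₁) (hG₂ : IsCylindricalOn G₂ U₂)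
    (h₁ : projLeft E₁ E₂ z ∈ U₁) (h₂ : projRight E₁ E₂ z ∈ U₂)
    (hS₁ : ∀ v, v ≠ 0 → 0 < shapeForm G₁ (projLeft E₁ E₂ z) v v)
    (hS₂ : ∀ v, v ≠ 0 → 0 < shapeForm G₂ (projRight E₁ E₂ z) v v)
    (hK₁ : ∀ u v, LinearIndependent ℝ ![u, v] → curvatureForm G₁ (projLeft E₁ E₂ z) u v < 0)
    (hK₂ : ∀ u v, LinearIndependent ℝ ![u, v] → curvatureForm G₂ (projRight E₁ E₂ z) u v < 0)
    {u v : ℝ × E₁ × E₂} (huv : LinearIndependent ℝ ![u, v]) :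
    curvatureForm (sumForm G₁ G₂) z u v < 0 := by
  rw [curvatureForm_sumForm hG₁ hG₂ h₁ h₂]
  have hS₁' (v) : 0 ≤ shapeForm G₁ (projLeft E₁ E₂ z) v v := by
    rcases eq_or_ne v 0 with rfl | hv
    · simp
    · exact (hS₁ v hv).le
  have hS₂' (v) : 0 ≤ shapeForm G₂ (projRight E₁ E₂ z) v v := by
    rcases eq_or_ne v 0 with rfl | hv
    · simp
    · exact (hS₂ v hv).le
  have hQ := mixedForm_nonneg hS₁' (hG₁.shapeForm_symm h₁) hS₂' (hG₂.shapeForm_symm h₂)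
    u.2.1 v.2.1 u.2.2 v.2.2
  -- One nondegenerate projection already gives a strict sign; only when both degenerate must the
  -- mixed term supply it.
  by_cases hd₁ : LinearIndependent ℝ ![projLeft E₁ E₂ u, projLeft E₁ E₂ v] <;>
  by_cases hd₂ : LinearIndependent ℝ ![projRight E₁ E₂ u, projRight E₁ E₂ v]
  · linarith [hK₁ _ _ hd₁, hK₂ _ _ hd₂]
  · linarith [hK₁ _ _ hd₁, curvatureForm_eq_zero G₂ (projRight E₁ E₂ z) hd₂]
  · linarith [hK₂ _ _ hd₂, curvatureForm_eq_zero G₁ (projLeft E₁ E₂ z) hd₁]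
  · linarith [curvatureForm_eq_zero G₁ (projLeft E₁ E₂ z) hd₁,
      curvatureForm_eq_zero G₂ (projRight E₁ E₂ z) hd₂, mixedForm_pos hS₁ hS₂ huv hd₁ hd₂]

lemma abs_curvatureForm_sumForm_le (hG₁ : IsCylindricalOn G₁ U₁) (hG₂ : IsCylindricalOn G₂ U₂)
    (h₁ : projLeft E₁ E₂ z ∈ U₁) (h₂ : projRight E₁ E₂ z ∈ U₂)
    (hS₁ : ∀ v, 0 ≤ shapeForm G₁ (projLeft E₁ E₂ z) v v)
    (hS₂ : ∀ v, 0 ≤ shapeForm G₂ (projRight E₁ E₂ z) v v) {C K : ℝ} (hC : 0 ≤ C) (hK : 0 ≤ K)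
    (hC₁ : ∀ v, shapeForm G₁ (projLeft E₁ E₂ z) v v ≤ C * sliceForm G₁ (projLeft E₁ E₂ z) v v)
    (hC₂ : ∀ v, shapeForm G₂ (projRight E₁ E₂ z) v v ≤ C * sliceForm G₂ (projRight E₁ E₂ z) v v)
    (hK₁ : ∀ u v, |curvatureForm G₁ (projLeft E₁ E₂ z) u v| ≤ K * gram (G₁ (projLeft E₁ E₂ z)) u v)
    (hK₂ : ∀ u v, |curvatureForm G₂ (projRight E₁ E₂ z) u v|
      ≤ K * gram (G₂ (projRight E₁ E₂ z)) u v) (u v : ℝ × E₁ × E₂) :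
    |curvatureForm (sumForm G₁ G₂) z u v| ≤ (K + C ^ 2) * gram (sumForm G₁ G₂ z) u v := by
  rw [curvatureForm_sumForm hG₁ hG₂ h₁ h₂, gram_sumForm hG₁ hG₂ h₁ h₂]
  have hQ := mixedForm_nonneg hS₁ (hG₁.shapeForm_symm h₁) hS₂ (hG₂.shapeForm_symm h₂)
    u.2.1 v.2.1 u.2.2 v.2.2
  have hg' := mixedForm_nonneg (hG₁.sliceForm_nonneg h₁) (fun v w => hG₁.symm _ h₁ _ _) (hG₂.sliceForm_nonneg h₂)
    (fun v w => hG₂.symm _ h₂ _ _) u.2.1 v.2.1 u.2.2 v.2.2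
  have hle := mixedForm_le hS₁ (hG₁.shapeForm_symm h₁) (hG₂.shapeForm_symm h₂)
    (fun v w => hG₁.symm _ h₁ _ _) (hG₂.sliceForm_nonneg h₂) (fun v w => hG₂.symm _ h₂ _ _) hC hC₁ hC₂
    u.2.1 v.2.1 u.2.2 v.2.2
  have k₁ := abs_le.1 (hK₁ (projLeft E₁ E₂ u) (projLeft E₁ E₂ v))
  have k₂ := abs_le.1 (hK₂ (projRight E₁ E₂ u) (projRight E₁ E₂ v))
  have m₁ := mul_nonneg (sq_nonneg C)
    (gram_nonneg (hG₁.pos _ h₁) (hG₁.symm _ h₁) (projLeft E₁ E₂ u) (projLeft E₁ E₂ v))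
  have m₂ := mul_nonneg (sq_nonneg C)
    (gram_nonneg (hG₂.pos _ h₂) (hG₂.symm _ h₂) (projRight E₁ E₂ u) (projRight E₁ E₂ v))
  have m₃ := mul_nonneg hK hg'
  rw [abs_le]
  constructor <;> linarith [k₁.1, k₁.2, k₂.1, k₂.2]

end Curvature

/-! ### Curvature conclusions on the manifold. -/

section ProductCurvature

variable {E : Type*} [NormedAddCommGroup E] [NormedSpace ℝ E]
  {H : Type*} [TopologicalSpace H] {I : ModelWithCorners ℝ E H} [I.Boundaryless]
  {B : Type*} [TopologicalSpace B] [ChartedSpace H B] [IsManifold I ∞ B]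

lemma sectionalCurvature_eq_div (g : FormField I B) (p : B) (u v : E) :
    sectionalCurvature g p u v =
      curvatureForm (inChart g p) (extChartAt I p p) u v
        / gram (inChart g p (extChartAt I p p)) u v := by
  refine (sectionalCurvature_eq g p u v).trans (congrArg₂ (· / ·) rfl ?_)
  exact (congrArg₂ (· - ·) (congrArg₂ (· * ·) (inChart_self g p u u) (inChart_self g p v v))
    (congrArg (· ^ 2) (inChart_self g p u v))).symm

lemma sliceForm_cylinder (g : ℝ → FormField I B) (r : ℝ) (b : B) (v w : E) :
    sliceForm (inChart (cylinder g) (r, b)) (extChartAt (𝓘(ℝ, ℝ).prod I) (r, b) (r, b)) v w =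
      (g r b : E →L[ℝ] E →L[ℝ] ℝ) v w := by
  rw [sliceForm_apply]
  refine (inChart_self (cylinder g) (r, b) ((0 : ℝ), v) ((0 : ℝ), w)).trans ?_
  have : cylinder g (r, b) ((0 : ℝ), v) ((0 : ℝ), w) =
    0 * 0 + (g r b : E →L[ℝ] E →L[ℝ] ℝ) v w := rfl
  rw [this, zero_mul, zero_add]

namespace IsRiemannianMetric

variable {g : FormField I B}

lemma gram_inChart_pos (hg : IsRiemannianMetric g) (p : B) {u v : E}
    (huv : LinearIndependent ℝ ![u, v]) : 0 < gram (inChart g p (extChartAt I p p)) u v :=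
  gram_pos (hg.inChart_pos (mem_extChartAt_target p)) (hg.inChart_symm p _) huv

lemma curvatureForm_neg (hg : IsRiemannianMetric g) (hK : NegativeCurvature g) (p : B) (u v : E)
    (huv : LinearIndependent ℝ ![u, v]) :
    curvatureForm (inChart g p) (extChartAt I p p) u v < 0 := by
  have h := hK p u v huv
  rw [sectionalCurvature_eq_div] at h
  rwa [div_lt_iff₀ (hg.gram_inChart_pos p huv), zero_mul] at h

lemma abs_curvatureForm_le (hg : IsRiemannianMetric g) {C : ℝ} {p : B}
    (hK : ∀ u v : E, LinearIndependent ℝ ![u, v] →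
      |sectionalCurvature g p u v| ≤ C) (u v : E) :
    |curvatureForm (inChart g p) (extChartAt I p p) u v| ≤
      C * gram (inChart g p (extChartAt I p p)) u v := by
  by_cases huv : LinearIndependent ℝ ![u, v]
  · have h := hK u v huv
    have hpos := hg.gram_inChart_pos p huv
    rwa [sectionalCurvature_eq_div, abs_div, abs_of_pos hpos, div_le_iff₀ hpos] at h
  · rw [curvatureForm_eq_zero _ _ huv, gram_eq_zero huv]
    simp

end IsRiemannianMetric

lemma secondFundamentalForm_eq [FiniteDimensional ℝ E] {g : ℝ → FormField I B}
    (hg : IsMetricFamily g) (r : ℝ) (b : B) (v w : E) :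
    secondFundamentalForm g r b v w =
      -shapeForm (inChart (cylinder g) (r, b)) (extChartAt (𝓘(ℝ, ℝ).prod I) (r, b) (r, b))
        v w := by
  have hG := hg.isCylindricalOn (r, b)
  have hx := mem_extChartAt_target (I := 𝓘(ℝ, ℝ).prod I) (r, b)
  simp only [secondFundamentalForm, coords_eq]
  rw [hG.symm _ hx _ (1, 0), hG.normal _ hx, shapeForm_apply, neg_neg]

variable {E' : Type*} [NormedAddCommGroup E'] [NormedSpace ℝ E']
  {H' : Type*} [TopologicalSpace H'] {I' : ModelWithCorners ℝ E' H'} [I'.Boundaryless]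
  {B' : Type*} [TopologicalSpace B'] [ChartedSpace H' B'] [IsManifold I' ∞ B']

omit [I.Boundaryless] [IsManifold I ∞ B] [I'.Boundaryless] [IsManifold I' ∞ B'] in
lemma projLeft_extChartAt (r : ℝ) (b : B) (b' : B') :
    projLeft E E' (extChartAt (𝓘(ℝ, ℝ).prod (I.prod I')) (r, b, b') (r, b, b')) =
      extChartAt (𝓘(ℝ, ℝ).prod I) (r, b) (r, b) := by
  rw [extChartAt_prod, extChartAt_prod, extChartAt_prod]
  rfl

omit [I.Boundaryless] [IsManifold I ∞ B] [I'.Boundaryless] [IsManifold I' ∞ B'] in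
lemma projRight_extChartAt (r : ℝ) (b : B) (b' : B') :
    projRight E E' (extChartAt (𝓘(ℝ, ℝ).prod (I.prod I')) (r, b, b') (r, b, b')) =
      extChartAt (𝓘(ℝ, ℝ).prod I') (r, b') (r, b') := by
  rw [extChartAt_prod, extChartAt_prod, extChartAt_prod]
  rfl

/-- Curvature involves derivatives, so the two expressions must agree near the point; they agree on
the whole open chart target. -/
lemma inChart_cylinder_prodFamily_eventuallyEq (g : ℝ → FormField I B) (g' : ℝ → FormField I' B')
    (r : ℝ) (b : B) (b' : B') :
    inChart (cylinder (prodFamily g g')) (r, b, b')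
      =ᶠ[nhds (extChartAt (𝓘(ℝ, ℝ).prod (I.prod I')) (r, b, b') (r, b, b'))]
      sumForm (inChart (cylinder g) (r, b)) (inChart (cylinder g') (r, b')) := by
  filter_upwards [(isOpen_extChartAt_target (I := 𝓘(ℝ, ℝ).prod (I.prod I'))
    ((r, b, b') : ℝ × B × B')).mem_nhds (mem_extChartAt_target _)] with z hz
  have h := mem_target_prod.1 (mem_target_cylinder.1 hz)
  exact inChart_cylinder_prodFamily g g' (r, b, b') h.1 h.2

variable {g : ℝ → FormField I B} {g' : ℝ → FormField I' B'}

/-- The curvature of `dr² + g_r + g'_r` in terms of that of `dr² + g_r` and `dr² + g'_r`. -/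
lemma sectionalCurvature_prodFamily (r : ℝ) (b : B) (b' : B')
    (u v : ℝ × E × E') :
    sectionalCurvature (cylinder (prodFamily g g')) (r, b, b') u v =
      curvatureForm (sumForm (inChart (cylinder g) (r, b)) (inChart (cylinder g') (r, b')))
        (extChartAt (𝓘(ℝ, ℝ).prod (I.prod I')) (r, b, b') (r, b, b')) u v
      / gram (sumForm (inChart (cylinder g) (r, b)) (inChart (cylinder g') (r, b'))
        (extChartAt (𝓘(ℝ, ℝ).prod (I.prod I')) (r, b, b') (r, b, b'))) u v := by
  have hev := inChart_cylinder_prodFamily_eventuallyEq g g' r b b'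
  rw [sectionalCurvature_eq_div, curvatureForm, riemann_congr hev, hev.eq_of_nhds]
  rfl

variable [FiniteDimensional ℝ E] [FiniteDimensional ℝ E']

lemma secondFundamentalForm_prodFamily (hg : IsMetricFamily g) (hg' : IsMetricFamily g')
    (r : ℝ) (b : B) (b' : B') (v w : E × E') :
    secondFundamentalForm (prodFamily g g') r (b, b') v w =
      secondFundamentalForm g r b v.1 w.1 + secondFundamentalForm g' r b' v.2 w.2 := by
  have hG := hg.isCylindricalOn (r, b)
  have hG' := hg'.isCylindricalOn (r, b')
  have h₁ := mem_extChartAt_target (I := 𝓘(ℝ, ℝ).prod I) (r, b)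
  have h₂ := mem_extChartAt_target (I := 𝓘(ℝ, ℝ).prod I') (r, b')
  have hev := inChart_cylinder_prodFamily_eventuallyEq g g' r b b'
  rw [secondFundamentalForm_eq hg, secondFundamentalForm_eq hg']
  rw [← projLeft_extChartAt (I := I) (I' := I') r b b'] at h₁ ⊢
  rw [← projRight_extChartAt (I := I) (I' := I') r b b'] at h₂ ⊢
  simp only [secondFundamentalForm, coords_eq]
  rw [hev.eq_of_nhds, christoffel_congr hev, christoffel_sumForm hG hG' h₁ h₂,
    sumForm_incl hG hG' h₁ h₂]
  have e₁ : projLeft E E' ((1 : ℝ), (0 : E × E')) = (1, 0) := rfl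
  have e₂ : projRight E E' ((1 : ℝ), (0 : E × E')) = (1, 0) := rfl
  refine (congrArg₂ (fun a a' => inChart (cylinder g) (r, b) _ _ a
    + inChart (cylinder g') (r, b') _ _ a') e₁ e₂).trans ?_
  rw [hG.symm _ h₁ _ (1, 0), hG.normal _ h₁, hG'.symm _ h₂ _ (1, 0), hG'.normal _ h₂,
    shapeForm_apply, shapeForm_apply, neg_neg, neg_neg]
  rfl

/-- Test on vectors tangent to one factor: the second fundamental form of the product is the sum of
those of the factors. The point `b'` only serves to lift points of `B` to the product. -/
lemma NegativeDefiniteII.left (hg : IsMetricFamily g) (hg' : IsMetricFamily g')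
    (hII : NegativeDefiniteII (prodFamily g g')) (b' : B') : NegativeDefiniteII g := by
  intro r b v hv
  have h := hII r (b, b') ((v, 0) : E × E') (fun h => hv (congrArg Prod.fst h))
  rw [secondFundamentalForm_prodFamily hg hg', secondFundamentalForm_eq hg' r b' 0 0] at h
  rwa [(map_zero _ : shapeForm _ _ (0 : E') = 0), LinearMap.zero_apply, neg_zero, add_zero] at h

lemma NegativeDefiniteII.right (hg : IsMetricFamily g) (hg' : IsMetricFamily g')
    (hII : NegativeDefiniteII (prodFamily g g')) (b : B) : NegativeDefiniteII g' := by
  intro r b' v hv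
  have h := hII r (b, b') ((0, v) : E × E') (fun h => hv (congrArg Prod.snd h))
  rw [secondFundamentalForm_prodFamily hg hg', secondFundamentalForm_eq hg r b 0 0] at h
  rwa [(map_zero _ : shapeForm _ _ (0 : E) = 0), LinearMap.zero_apply, neg_zero, zero_add] at h

lemma NegativeDefiniteII.shapeForm_pos (hg : IsMetricFamily g) (hII : NegativeDefiniteII g)
    (r : ℝ) (b : B) (v : E) (hv : v ≠ 0) :
    0 < shapeForm (inChart (cylinder g) (r, b)) (extChartAt (𝓘(ℝ, ℝ).prod I) (r, b) (r, b))
      v v := by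
  have h := hII r b v hv
  rwa [secondFundamentalForm_eq hg, neg_lt_zero] at h

theorem negativeCurvature_cylinder_prodFamily (hg : IsMetricFamily g) (hg' : IsMetricFamily g')
    (hII : NegativeDefiniteII (prodFamily g g')) (hK : NegativeCurvature (cylinder g))
    (hK' : NegativeCurvature (cylinder g')) :
    NegativeCurvature (cylinder (prodFamily g g')) := by
  rintro ⟨r, b, b'⟩ (u : ℝ × E × E') (v : ℝ × E × E') huv
  have hG := hg.isCylindricalOn (r, b)
  have hG' := hg'.isCylindricalOn (r, b')
  have h₁ := mem_extChartAt_target (I := 𝓘(ℝ, ℝ).prod I) (r, b)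
  have h₂ := mem_extChartAt_target (I := 𝓘(ℝ, ℝ).prod I') (r, b')
  have hS₁ := (hII.left hg hg' b').shapeForm_pos hg r b
  have hS₂ := (hII.right hg hg' b).shapeForm_pos hg' r b'
  have hK₁ := IsRiemannianMetric.curvatureForm_neg hg hK (r, b)
  have hK₂ := IsRiemannianMetric.curvatureForm_neg hg' hK' (r, b')
  rw [← projLeft_extChartAt (I := I) (I' := I') r b b'] at h₁ hS₁ hK₁
  rw [← projRight_extChartAt (I := I) (I' := I') r b b'] at h₂ hS₂ hK₂
  rw [sectionalCurvature_prodFamily]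
  exact div_neg_of_neg_of_pos
    (curvatureForm_sumForm_neg hG hG' h₁ h₂ hS₁ hS₂ hK₁ hK₂ huv)
    (gram_pos (sumForm_pos hG hG' h₁ h₂) (sumForm_symm hG hG' h₁ h₂) huv)

lemma NegativeDefiniteII.shapeForm_nonneg (hg : IsMetricFamily g) (hII : NegativeDefiniteII g)
    (r : ℝ) (b : B) (v : E) :
    0 ≤ shapeForm (inChart (cylinder g) (r, b)) (extChartAt (𝓘(ℝ, ℝ).prod I) (r, b) (r, b))
      v v := by
  rcases eq_or_ne v 0 with rfl | hv
  · simp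
  · exact (hII.shapeForm_pos hg r b v hv).le

lemma shapeForm_le_of_abs_le (hg : IsMetricFamily g) {r : ℝ} {b : B} {v : E} {C : ℝ}
    (hC : |secondFundamentalForm g r b v v| ≤
      C * √((g r b : E →L[ℝ] E →L[ℝ] ℝ) v v) * √((g r b : E →L[ℝ] E →L[ℝ] ℝ) v v)) :
    shapeForm (inChart (cylinder g) (r, b)) (extChartAt (𝓘(ℝ, ℝ).prod I) (r, b) (r, b)) v v ≤
      max 0 C *
        sliceForm (inChart (cylinder g) (r, b)) (extChartAt (𝓘(ℝ, ℝ).prod I) (r, b) (r, b))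
          v v := by
  have hn := (hg.isCylindricalOn (r, b)).sliceForm_nonneg
    (mem_extChartAt_target (I := 𝓘(ℝ, ℝ).prod I) (r, b)) v
  rw [secondFundamentalForm_eq hg, ← sliceForm_cylinder, mul_assoc, Real.mul_self_sqrt hn,
    abs_neg] at hC
  exact (le_abs_self _).trans (hC.trans (mul_le_mul_of_nonneg_right (le_max_right 0 C) hn))

lemma secondFundamentalForm_zero (hg : IsMetricFamily g) (r : ℝ) (b : B) :
    secondFundamentalForm g r b (0 : E) (0 : E) = 0 := by
  rw [secondFundamentalForm_eq hg, map_zero, neg_zero]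

theorem boundedCurvature_cylinder_prodFamily (hg : IsMetricFamily g) (hg' : IsMetricFamily g')
    (hII : NegativeDefiniteII (prodFamily g g')) (hK : BoundedCurvature (cylinder g))
    (hK' : BoundedCurvature (cylinder g')) (hb : BoundedII (prodFamily g g')) :
    BoundedCurvature (cylinder (prodFamily g g')) := by
  obtain ⟨K, hK⟩ := hK
  obtain ⟨K', hK'⟩ := hK'
  obtain ⟨C, hC⟩ := hb
  -- The given constants may be negative, for instance when a cylinder has no tangent planes; the
  -- maxima with `0` supply the signs used in the estimate.
  refine ⟨max 0 (max K K') + (max 0 C) ^ 2, ?_⟩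
  rintro ⟨r, b, b'⟩ (u : ℝ × E × E') (v : ℝ × E × E') huv
  have hG := hg.isCylindricalOn (r, b)
  have hG' := hg'.isCylindricalOn (r, b')
  have h₁ := mem_extChartAt_target (I := 𝓘(ℝ, ℝ).prod I) (r, b)
  have h₂ := mem_extChartAt_target (I := 𝓘(ℝ, ℝ).prod I') (r, b')
  have hS₁ := (hII.left hg hg' b').shapeForm_nonneg hg r b
  have hS₂ := (hII.right hg hg' b).shapeForm_nonneg hg' r b'
  have hC₁ (v : E) := shapeForm_le_of_abs_le hg (r := r) (b := b) (v := v) (C := C) (by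
    have h := hC r (b, b') ((v, 0) : E × E') ((v, 0) : E × E')
    have e : (prodFamily g g' r (b, b') : E × E' →L[ℝ] E × E' →L[ℝ] ℝ) (v, 0) (v, 0) =
      (g r b : E →L[ℝ] E →L[ℝ] ℝ) v v + (g' r b' : E' →L[ℝ] E' →L[ℝ] ℝ) 0 0 := rfl
    rw [secondFundamentalForm_prodFamily hg hg', secondFundamentalForm_zero hg', add_zero, e,
      map_zero, add_zero] at h
    exact h)
  have hC₂ (v : E') := shapeForm_le_of_abs_le hg' (r := r) (b := b') (v := v) (C := C) (by
    have h := hC r (b, b') ((0, v) : E × E') ((0, v) : E × E')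
    have e : (prodFamily g g' r (b, b') : E × E' →L[ℝ] E × E' →L[ℝ] ℝ) (0, v) (0, v) =
      (g r b : E →L[ℝ] E →L[ℝ] ℝ) 0 0 + (g' r b' : E' →L[ℝ] E' →L[ℝ] ℝ) v v := rfl
    rw [secondFundamentalForm_prodFamily hg hg', secondFundamentalForm_zero hg, zero_add, e,
      map_zero, zero_add] at h
    exact h)
  have hK₁ := IsRiemannianMetric.abs_curvatureForm_le hg (p := (r, b))
    (C := max 0 (max K K')) fun u v huv =>
      (hK (r, b) u v huv).trans ((le_max_left K K').trans (le_max_right _ _))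
  have hK₂ := IsRiemannianMetric.abs_curvatureForm_le hg' (p := (r, b'))
    (C := max 0 (max K K')) fun u v huv =>
      (hK' (r, b') u v huv).trans ((le_max_right K K').trans (le_max_right _ _))
  rw [← projLeft_extChartAt (I := I) (I' := I') r b b'] at h₁ hS₁ hK₁
  rw [← projRight_extChartAt (I := I) (I' := I') r b b'] at h₂ hS₂ hK₂
  simp only [← projLeft_extChartAt (I := I) (I' := I') r b b'] at hC₁
  simp only [← projRight_extChartAt (I := I) (I' := I') r b b'] at hC₂
  have hpos := gram_pos (sumForm_pos hG hG' h₁ h₂) (sumForm_symm hG hG' h₁ h₂) huv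
  rw [sectionalCurvature_prodFamily, abs_div, abs_of_pos hpos, div_le_iff₀ hpos]
  exact abs_curvatureForm_sumForm_le hG hG' h₁ h₂ hS₁ hS₂ (le_max_left _ _) (le_max_left _ _)
    hC₁ hC₂ hK₁ hK₂ u v

end ProductCurvature

/-! ### Gram determinants, the squares of volume densities. -/

section GramDeterminant

variable {E : Type*} [NormedAddCommGroup E] [NormedSpace ℝ E]
  {ι : Type*} [Fintype ι] [DecidableEq ι]

/-- The determinant of the matrix of `A` with respect to the basis `b`. -/
def gramDet (b : Module.Basis ι ℝ E) (A : E →L[ℝ] E →L[ℝ] ℝ) : ℝ :=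
  (Matrix.of fun i j => A (b i) (b j)).det

lemma gramDet_reindex {κ : Type*} [Fintype κ] [DecidableEq κ] (b : Module.Basis ι ℝ E)
    (e : ι ≃ κ) (A : E →L[ℝ] E →L[ℝ] ℝ) : gramDet (b.reindex e) A = gramDet b A := by
  rw [gramDet, gramDet, ← Matrix.det_submatrix_equiv_self e]
  congr 1
  ext i j
  simp

lemma gramDet_eq_sq_mul (b b' : Module.Basis ι ℝ E) (A : E →L[ℝ] E →L[ℝ] ℝ) :
    gramDet b A = (b'.toMatrix b).det ^ 2 * gramDet b' A := by
  let A' : LinearMap.BilinForm ℝ E := LinearMap.mk₂ ℝ (fun v w => A v w) (by simp) (by simp)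
    (by simp) (by simp)
  have h (c : Module.Basis ι ℝ E) :
      (Matrix.of fun i j => A (c i) (c j)) = LinearMap.BilinForm.toMatrix c A' := by
    ext i j
    rw [LinearMap.BilinForm.toMatrix_apply]
    rfl
  rw [gramDet, gramDet, h, h, ← LinearMap.BilinForm.toMatrix_mul_basis_toMatrix b' b A']
  simp only [Matrix.det_mul, Matrix.det_transpose]
  ring

lemma gramDet_of_orthogonal (b : Module.Basis ι ℝ E) {A : E →L[ℝ] E →L[ℝ] ℝ}
    (hA : ∀ i j, i ≠ j → A (b i) (b j) = 0) : gramDet b A = ∏ i, A (b i) (b i) := by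
  have : (Matrix.of fun i j => A (b i) (b j)) = Matrix.diagonal fun i => A (b i) (b i) := by
    ext i j
    rcases eq_or_ne i j with rfl | h
    · simp
    · simp [h, hA i j h]
  rw [gramDet, this, Matrix.det_diagonal]

lemma gramDet_nonneg_of_orthogonal (b b' : Module.Basis ι ℝ E) {A : E →L[ℝ] E →L[ℝ] ℝ}
    (hA : ∀ i j, i ≠ j → A (b' i) (b' j) = 0) (hA' : ∀ v, 0 ≤ A v v) : 0 ≤ gramDet b A := by
  rw [gramDet_eq_sq_mul b b', gramDet_of_orthogonal b' hA]
  exact mul_nonneg (sq_nonneg _) (Finset.prod_nonneg fun i _ => hA' _)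

/-- If `A ≤ A'` are simultaneously diagonalizable then `det A ≤ det A'`. -/
lemma gramDet_le_of_orthogonal (b b' : Module.Basis ι ℝ E) {A A' : E →L[ℝ] E →L[ℝ] ℝ}
    (hA : ∀ i j, i ≠ j → A (b' i) (b' j) = 0) (hA' : ∀ i j, i ≠ j → A' (b' i) (b' j) = 0)
    (h0 : ∀ v, 0 ≤ A v v) (hle : ∀ v, A v v ≤ A' v v) : gramDet b A ≤ gramDet b A' := by
  rw [gramDet_eq_sq_mul b b' A, gramDet_eq_sq_mul b b' A', gramDet_of_orthogonal b' hA,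
    gramDet_of_orthogonal b' hA']
  exact mul_le_mul_of_nonneg_left
    (Finset.prod_le_prod (fun i _ => h0 _) fun i _ => hle _) (sq_nonneg _)

lemma continuousOn_gramDet {F : E → E →L[ℝ] E →L[ℝ] ℝ} {U : Set E} (b : Module.Basis ι ℝ E)
    (hF : ∀ v w, ContinuousOn (fun y => F y v w) U) :
    ContinuousOn (fun y => gramDet b (F y)) U := by
  simp only [gramDet, Matrix.det_apply]
  refine continuousOn_finsetSum _ fun σ _ => ?_
  exact (continuousOn_finsetProd _ fun i _ => hF _ _).const_smul _

variable {E' E'' : Type*} [NormedAddCommGroup E'] [NormedSpace ℝ E']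
  [NormedAddCommGroup E''] [NormedSpace ℝ E'']
  {κ : Type*} [Fintype κ] [DecidableEq κ]

lemma gramDet_prod (b' : Module.Basis ι ℝ E') (b'' : Module.Basis κ ℝ E'')
    (L : (E' × E'') ≃L[ℝ] E) {A : E →L[ℝ] E →L[ℝ] ℝ} {A' : E' →L[ℝ] E' →L[ℝ] ℝ}
    {A'' : E'' →L[ℝ] E'' →L[ℝ] ℝ}
    (hA : ∀ v w, A (L v) (L w) = A' v.1 w.1 + A'' v.2 w.2) :
    gramDet ((b'.prod b'').map L.toLinearEquiv) A = gramDet b' A' * gramDet b'' A'' := by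
  have h : (Matrix.of fun i j => A ((b'.prod b'').map L.toLinearEquiv i)
        ((b'.prod b'').map L.toLinearEquiv j)) =
      Matrix.fromBlocks (Matrix.of fun i j => A' (b' i) (b' j)) 0 0
        (Matrix.of fun i j => A'' (b'' i) (b'' j)) := by
    ext i j
    have hm (i : ι ⊕ κ) : (b'.prod b'').map L.toLinearEquiv i = L (b'.prod b'' i) := rfl
    rw [Matrix.of_apply, hm, hm, hA]
    rcases i with i | i <;> rcases j with j | j <;> simp
  rw [gramDet, h, Matrix.det_fromBlocks_zero₂₁]
  rfl

/-- Gram determinants of orthogonal sums are products, up to a constant depending on the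
bases only. -/
lemma exists_sqrt_gramDet_eq [FiniteDimensional ℝ E] [FiniteDimensional ℝ E']
    [FiniteDimensional ℝ E''] (L : (E' × E'') ≃L[ℝ] E) :
    ∃ k : ℝ, 0 ≤ k ∧ ∀ (A : E →L[ℝ] E →L[ℝ] ℝ) (A' : E' →L[ℝ] E' →L[ℝ] ℝ)
      (A'' : E'' →L[ℝ] E'' →L[ℝ] ℝ),
      (∀ v w, A (L v) (L w) = A' v.1 w.1 + A'' v.2 w.2) →
      0 ≤ gramDet (Module.finBasis ℝ E'') A'' →
      √(gramDet (Module.finBasis ℝ E) A) =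
        k * (√(gramDet (Module.finBasis ℝ E') A') * √(gramDet (Module.finBasis ℝ E'') A'')) := by
  let β := ((Module.finBasis ℝ E').prod (Module.finBasis ℝ E'')).map L.toLinearEquiv
  let e := β.indexEquiv (Module.finBasis ℝ E)
  -- The chosen basis of `E` need not be the image of the product basis; `k` is the absolute
  -- determinant of the change of basis.
  refine ⟨√((((β.reindex e)).toMatrix (Module.finBasis ℝ E)).det ^ 2), Real.sqrt_nonneg _,
    fun A A' A'' hA h0 => ?_⟩
  rw [gramDet_eq_sq_mul _ (β.reindex e), gramDet_reindex, gramDet_prod _ _ L hA,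
    Real.sqrt_mul (sq_nonneg _), Real.sqrt_mul' _ h0]

end GramDeterminant

/-! ### Push-forwards of products of measures with densities. -/

section ProductMeasure

variable {X Y M N : Type*} [MeasurableSpace X] [MeasurableSpace Y] [MeasurableSpace M]
  [MeasurableSpace N]

/-- Inverse charts are controlled only on their targets, so they are merely a.e. measurable for the
restricted measures. Measurable modifications change their product map only on a null set. -/
lemma map_prod_map_of_aemeasurable {μ : Measure X} {ν : Measure Y} [SFinite μ] [SFinite ν]
    {f : X → M} {g : Y → N} (hf : AEMeasurable f μ) (hg : AEMeasurable g ν) :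
    (μ.map f).prod (ν.map g) = (μ.prod ν).map (Prod.map f g) ∧
      AEMeasurable (Prod.map f g) (μ.prod ν) := by
  have h : Prod.map f g =ᵐ[μ.prod ν] Prod.map (hf.mk f) (hg.mk g) := by
    have h₁ := Measure.quasiMeasurePreserving_fst (μ := μ) (ν := ν) |>.ae_eq_comp hf.ae_eq_mk
    have h₂ := Measure.quasiMeasurePreserving_snd (μ := μ) (ν := ν) |>.ae_eq_comp hg.ae_eq_mk
    filter_upwards [h₁, h₂] with z hz₁ hz₂ using Prod.ext hz₁ hz₂
  refine ⟨?_, ⟨_, hf.measurable_mk.prodMap hg.measurable_mk, h⟩⟩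
  rw [Measure.map_congr h, Measure.map_congr hf.ae_eq_mk, Measure.map_congr hg.ae_eq_mk,
    Measure.map_prod_map _ _ hf.measurable_mk hg.measurable_mk]

variable {Z P : Type*} [MeasurableSpace Z] [MeasurableSpace P]

/-- Comparison of a measure given by a density in a product chart with the product of measures
given by densities in the factors. -/
lemma map_withDensity_le_map_prod {μ : Measure X} {ν : Measure Y} [SFinite μ] [SFinite ν]
    (l : X × Y ≃ᵐ Z) {e : M × N → P} (he : Measurable e) {φ : X → M} {ψ : Y → N} {χ : Z → P}
    {U : Set X} {V : Set Y} {W : Set Z} (hU : MeasurableSet U) (hV : MeasurableSet V)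
    (hW : l ⁻¹' W = U ×ˢ V) (hφ : AEMeasurable φ (μ.restrict U)) (hψ : AEMeasurable ψ (ν.restrict V))
    (hχ : ∀ x ∈ U, ∀ y ∈ V, χ (l (x, y)) = e (φ x, ψ y))
    {f : X → ℝ≥0∞} {g : Y → ℝ≥0∞} {h : Z → ℝ≥0∞}
    (hf : AEMeasurable f (μ.restrict U)) (hg : AEMeasurable g (ν.restrict V)) {k : ℝ≥0∞}
    (hk : k ≠ ⊤) (hfg : ∀ x ∈ U, ∀ y ∈ V, h (l (x, y)) ≤ k * (f x * g y)) :
    ((((μ.prod ν).map l).restrict W).withDensity h).map χ ≤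
      k • ((((μ.restrict U).withDensity f).map φ).prod
        (((ν.restrict V).withDensity g).map ψ)).map e := by
  have hρ : ((μ.restrict U).withDensity f).prod ((ν.restrict V).withDensity g) =
      ((μ.prod ν).restrict (U ×ˢ V)).withDensity fun z => f z.1 * g z.2 := by
    rw [prod_withDensity₀ hf hg, Measure.prod_restrict]
  obtain ⟨h₁, h₂⟩ := map_prod_map_of_aemeasurable
    (hφ.mono_ac (withDensity_absolutelyContinuous _ f))
    (hψ.mono_ac (withDensity_absolutelyContinuous _ g))
  -- Otherwise the push-forward on the left is zero by convention.
  by_cases hm : AEMeasurable χ ((((μ.prod ν).map l).restrict W).withDensity h)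
  swap
  · rw [Measure.map_of_not_aemeasurable hm]
    exact Measure.zero_le _
  have hle : (((μ.prod ν).map l).restrict W).withDensity h ≤
      k • (((μ.prod ν).restrict (U ×ˢ V)).withDensity fun z => f z.1 * g z.2).map l := by
    refine Measure.le_iff.2 fun A hA => ?_
    have hlA : MeasurableSet (l ⁻¹' A) := l.measurable hA
    rw [withDensity_apply _ hA, Measure.restrict_restrict hA,
      l.measurableEmbedding.restrict_map, l.measurableEmbedding.lintegral_map, Measure.smul_apply, l.map_apply,
      withDensity_apply _ hlA, Measure.restrict_restrict hlA, Set.preimage_inter, hW, smul_eq_mul,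
      ← lintegral_const_mul' _ _ hk]
    refine setLIntegral_mono' (hlA.inter (hU.prod hV)) fun z hz => ?_
    exact hfg z.1 hz.2.1 z.2 hz.2.2
  refine Measure.le_iff.2 fun A hA => ?_
  rw [Measure.map_apply_of_aemeasurable hm hA, Measure.smul_apply, Measure.map_apply he hA, h₁,
    Measure.map_apply_of_aemeasurable h₂ (he hA), hρ]
  refine (hle _).trans ?_
  rw [Measure.smul_apply, l.map_apply]
  -- `χ ∘ l` and `e ∘ (φ × ψ)` agree only on `U ×ˢ V`, which carries the measure.
  refine le_of_eq (congrArg (k • ·) (measure_congr ?_))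
  refine (withDensity_absolutelyContinuous _ _).ae_le ?_
  filter_upwards [ae_restrict_mem (hU.prod hV)] with z hz
  exact congrArg A (hχ z.1 hz.1 z.2 hz.2)

end ProductMeasure

/-! ### Finiteness of Riemannian volume by comparison in product charts. -/

section Volume

variable {E : Type*} [NormedAddCommGroup E] [NormedSpace ℝ E] [FiniteDimensional ℝ E]
  [MeasurableSpace E] [BorelSpace E]
  {H : Type*} [TopologicalSpace H] {I : ModelWithCorners ℝ E H} [I.Boundaryless]
  {M : Type*} [TopologicalSpace M] [ChartedSpace H M] [MeasurableSpace M]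
  [BorelSpace M]

omit [FiniteDimensional ℝ E] in
lemma aemeasurable_extChartAt_symm (μ : Measure E) (x₀ : M) :
    AEMeasurable (extChartAt I x₀).symm (μ.restrict (extChartAt I x₀).target) :=
  (continuousOn_extChartAt_symm x₀).aemeasurable (isOpen_extChartAt_target x₀).measurableSet

lemma chartVolume_restrict (g : FormField I M) (x₀ : M) {S : Set M} (hS : MeasurableSet S) :
    (chartVolume g x₀).restrict S =
      Measure.map (extChartAt I x₀).symm
        (((Module.finBasis ℝ E).addHaar.restrict
          ((extChartAt I x₀).symm ⁻¹' S ∩ (extChartAt I x₀).target)).withDensity fun y =>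
            ENNReal.ofReal √(gramDet (Module.finBasis ℝ E) (inChart g x₀ y))) := by
  rw [← Measure.restrict_restrict' (isOpen_extChartAt_target x₀).measurableSet,
    ← restrict_withDensity', ← Measure.restrict_map_of_aemeasurable _ hS]
  · rfl
  · exact (aemeasurable_extChartAt_symm _ x₀).mono_ac (withDensity_absolutelyContinuous _ _)

variable {E' : Type*} [NormedAddCommGroup E'] [NormedSpace ℝ E'] [FiniteDimensional ℝ E']
  [MeasurableSpace E'] [BorelSpace E']
  {H' : Type*} [TopologicalSpace H'] {I' : ModelWithCorners ℝ E' H'} [I'.Boundaryless]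
  {M' : Type*} [TopologicalSpace M'] [ChartedSpace H' M']
  [MeasurableSpace M'] [BorelSpace M']
  {E'' : Type*} [NormedAddCommGroup E''] [NormedSpace ℝ E''] [FiniteDimensional ℝ E'']
  [MeasurableSpace E''] [BorelSpace E'']
  {H'' : Type*} [TopologicalSpace H''] {I'' : ModelWithCorners ℝ E'' H''} [I''.Boundaryless]
  {M'' : Type*} [TopologicalSpace M''] [ChartedSpace H'' M'']
  [MeasurableSpace M''] [BorelSpace M'']

/-- A supremum of measures is not computed set by set, so a single dominating measure is required:
`ν` on `S`, and infinite mass on the complement, which does not affect `S`. -/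
lemma iSup_measure_lt_top {X ι : Type*} [MeasurableSpace X] {μ : ι → Measure X} {ν : Measure X}
    {S : Set X} (hS : MeasurableSet S) (h : ∀ i, (μ i).restrict S ≤ ν) (hν : ν S < ⊤) :
    (⨆ i, μ i) S < ⊤ := by
  have hle : ⨆ i, μ i ≤ ν + (⊤ : Measure X).restrict Sᶜ := by
    refine iSup_le fun i => ?_
    rw [← Measure.restrict_add_restrict_compl (μ := μ i) hS]
    exact add_le_add (h i) (Measure.restrict_mono le_rfl le_top)
  refine (hle S).trans_lt ?_
  rwa [Measure.add_apply, Measure.restrict_apply hS, Set.inter_compl_self, measure_empty, add_zero]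

/-- The domain of a product manifold has finite volume if its metric is, in product charts, an
orthogonal sum of a metric on the first factor and a form whose Gram determinant is at most that
of a metric on the second factor, and both factors have finite volume. -/
theorem riemannianVolume_lt_top_of_product_charts {g : FormField I M} {g' : FormField I' M'}
    {g'' : FormField I'' M''} (L : (E' × E'') ≃L[ℝ] E) {e : M' × M'' → M} (he : Measurable e)
    {S : Set M} {S' : Set M'} (hS : MeasurableSet S) (hS' : IsOpen S')
    (heS : e ⁻¹' S = S' ×ˢ Set.univ)
    (hv' : riemannianVolume g' S' < ⊤) (hv'' : riemannianVolume g'' Set.univ < ⊤)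
    (hc' : ∀ x' v w, ContinuousOn (fun y => inChart g' x' y v w) (extChartAt I' x').target)
    (hc'' : ∀ x'' v w, ContinuousOn (fun y => inChart g'' x'' y v w) (extChartAt I'' x'').target)
    (h : ∀ x : M, ∃ (x' : M') (x'' : M''),
      L ⁻¹' (extChartAt I x).target = (extChartAt I' x').target ×ˢ (extChartAt I'' x'').target ∧
      ∀ y' ∈ (extChartAt I' x').target, ∀ y'' ∈ (extChartAt I'' x'').target,
        (extChartAt I x).symm (L (y', y'')) =
          e ((extChartAt I' x').symm y', (extChartAt I'' x'').symm y'') ∧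
        ((extChartAt I' x').symm y' ∈ S' → ∃ A : E'' →L[ℝ] E'' →L[ℝ] ℝ,
          (∀ v w, inChart g x (L (y', y'')) (L v) (L w) =
            inChart g' x' y' v.1 w.1 + A v.2 w.2) ∧
          0 ≤ gramDet (Module.finBasis ℝ E'') A ∧
          gramDet (Module.finBasis ℝ E'') A ≤
            gramDet (Module.finBasis ℝ E'') (inChart g'' x'' y''))) :
    riemannianVolume g S < ⊤ := by
  set μ := (Module.finBasis ℝ E).addHaar
  set μ' := (Module.finBasis ℝ E').addHaar
  set μ'' := (Module.finBasis ℝ E'').addHaar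
  let l : E' × E'' ≃ᵐ E := L.toHomeomorph.toMeasurableEquiv
  have hl (z : E' × E'') : l z = L z := rfl
  have : ((μ'.prod μ'').map l).IsAddHaarMeasure := L.isAddHaarMeasure_map (μ'.prod μ'')
  let c := Measure.addHaarScalarFactor μ ((μ'.prod μ'').map l)
  -- Uniqueness of Haar measure: the normalizations by the chosen bases differ by a constant,
  -- harmless for finiteness.
  have hμ : μ = (c : ℝ≥0∞) • (μ'.prod μ'').map l :=
    Measure.isAddLeftInvariant_eq_smul μ ((μ'.prod μ'').map l)
  obtain ⟨k, hk0, hk⟩ := exists_sqrt_gramDet_eq L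
  let V' := (riemannianVolume g').restrict S'
  have hV' : IsFiniteMeasure V' := ⟨by rwa [Measure.restrict_apply_univ]⟩
  have hV'' : IsFiniteMeasure (riemannianVolume g'') := ⟨hv''⟩
  -- The dominating measure must not depend on the chart; neither `c` nor `k` does, as both depend
  -- only on `L` and the chosen bases.
  refine iSup_measure_lt_top
    (ν := (c : ℝ≥0∞) • ENNReal.ofReal k • ((V'.prod (riemannianVolume g'')).map e)) hS
    (fun x => ?_) ?_
  swap
  · rw [Measure.smul_apply, Measure.smul_apply, Measure.map_apply he hS, heS, Measure.prod_prod]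
    exact ENNReal.mul_lt_top ENNReal.coe_lt_top (ENNReal.mul_lt_top ENNReal.ofReal_lt_top
      (ENNReal.mul_lt_top (measure_lt_top _ _) hv''))
  obtain ⟨x', x'', hT, hx⟩ := h x
  set T' := (extChartAt I' x').symm ⁻¹' S' ∩ (extChartAt I' x').target
  have hT'open : IsOpen T' := by
    have : T' = (extChartAt I' x').target ∩ (extChartAt I' x').symm ⁻¹' S' := Set.inter_comm _ _
    rw [this]
    exact (continuousOn_extChartAt_symm x').isOpen_inter_preimage (isOpen_extChartAt_target x') hS'
  have hT'' := (isOpen_extChartAt_target (I := I'') x'').measurableSet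
  have hW : l ⁻¹' ((extChartAt I x).symm ⁻¹' S ∩ (extChartAt I x).target) =
      T' ×ˢ (extChartAt I'' x'').target := by
    ext ⟨y', y''⟩
    have h₁ : L (y', y'') ∈ (extChartAt I x).target ↔
        y' ∈ (extChartAt I' x').target ∧ y'' ∈ (extChartAt I'' x'').target := by
      rw [← Set.mem_preimage, hT]
      exact Iff.rfl
    have h₂ (m' : M') (m'' : M'') : e (m', m'') ∈ S ↔ m' ∈ S' := by
      rw [← Set.mem_preimage, heS]; simp
    simp only [Set.mem_preimage, Set.mem_inter_iff, hl, h₁, Set.mem_prod, T']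
    constructor
    · rintro ⟨h₃, h₄, h₅⟩
      rw [(hx y' h₄ y'' h₅).1, h₂] at h₃
      exact ⟨⟨h₃, h₄⟩, h₅⟩
    · rintro ⟨⟨h₃, h₄⟩, h₅⟩
      rw [(hx y' h₄ y'' h₅).1, h₂]
      exact ⟨h₃, h₄, h₅⟩
  have hsub : T' ⊆ (extChartAt I' x').target := Set.inter_subset_right
  have key := map_withDensity_le_map_prod (μ := μ') (ν := μ'') l he hT'open.measurableSet hT'' hW
    ((aemeasurable_extChartAt_symm μ' x').mono_measure (Measure.restrict_mono hsub le_rfl))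
    (aemeasurable_extChartAt_symm μ'' x'')
    (χ := (extChartAt I x).symm) (fun y' hy' y'' hy'' => (hx y' hy'.2 y'' hy'').1)
    (f := fun y => ENNReal.ofReal √(gramDet (Module.finBasis ℝ E') (inChart g' x' y)))
    (g := fun y => ENNReal.ofReal √(gramDet (Module.finBasis ℝ E'') (inChart g'' x'' y)))
    (h := fun y => ENNReal.ofReal √(gramDet (Module.finBasis ℝ E) (inChart g x y)))
    (k := ENNReal.ofReal k)
    ((((continuousOn_gramDet _ (hc' x')).mono hsub).aemeasurable
      hT'open.measurableSet).sqrt.ennreal_ofReal)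
    (((continuousOn_gramDet _ (hc'' x'')).aemeasurable hT'').sqrt.ennreal_ofReal)
    ENNReal.ofReal_ne_top (fun y' hy' y'' hy'' => by
      obtain ⟨A, hA, hA0, hA'⟩ := (hx y' hy'.2 y'' hy'').2 hy'.1
      rw [hl, hk _ _ _ hA hA0, ENNReal.ofReal_mul hk0, ENNReal.ofReal_mul (Real.sqrt_nonneg _)]
      gcongr)
  rw [chartVolume_restrict g x hS, show (Module.finBasis ℝ E).addHaar = μ from rfl, hμ,
    Measure.restrict_smul, withDensity_smul_measure, Measure.map_smul]
  refine Measure.le_iff.2 fun A hA => ?_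
  rw [Measure.smul_apply, Measure.smul_apply]
  refine mul_le_mul_right (((key A).trans ?_)) _
  rw [Measure.smul_apply, Measure.smul_apply]
  refine mul_le_mul_right ?_ _
  refine (Measure.map_mono (Measure.prod_mono ?_ ?_) he) A
  · rw [← chartVolume_restrict g' x' hS'.measurableSet]
    exact Measure.restrict_mono le_rfl (le_iSup (chartVolume g') x')
  · exact le_iSup (chartVolume g'') x''

end Volume

/-! ### Monotonicity of `g_r` and of its volume density. -/

section Monotone

variable {E : Type*} [NormedAddCommGroup E] [NormedSpace ℝ E] [FiniteDimensional ℝ E]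
  {H : Type*} [TopologicalSpace H] {I : ModelWithCorners ℝ E H} [I.Boundaryless]
  {B : Type*} [TopologicalSpace B] [ChartedSpace H B] [IsManifold I ∞ B]
  {g : ℝ → FormField I B}

omit [FiniteDimensional ℝ E] [I.Boundaryless] in
lemma IsMetricFamily.apply_nonneg (hg : IsMetricFamily g) (r : ℝ) (b : B) (v : E) :
    0 ≤ (g r b : E →L[ℝ] E →L[ℝ] ℝ) v v := by
  rcases eq_or_ne v 0 with rfl | hv
  · exact (map_zero ((g r b : E →L[ℝ] E →L[ℝ] ℝ) 0)).ge
  · have h := IsRiemannianMetric.pos hg (r, b) ((0, v) : ℝ × E)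
      (fun h => hv (congrArg Prod.snd h))
    have e : cylinder g (r, b) ((0 : ℝ), v) ((0 : ℝ), v) =
      0 * 0 + (g r b : E →L[ℝ] E →L[ℝ] ℝ) v v := rfl
    have h' : 0 < cylinder g (r, b) ((0 : ℝ), v) ((0 : ℝ), v) := h
    rw [e, zero_mul, zero_add] at h'
    exact h'.le

lemma IsCylindricalOn.hasDerivAt {G : ℝ × E → (ℝ × E) →L[ℝ] (ℝ × E) →L[ℝ] ℝ}
    {U : Set (ℝ × E)} (hG : IsCylindricalOn G U) {r : ℝ} {y : E} (hx : (r, y) ∈ U) (v : E) :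
    HasDerivAt (fun s => G (s, y) (0, v) (0, v)) (2 * shapeForm G (r, y) v v) r := by
  have hcurve : HasDerivAt (fun s : ℝ => (s, y)) ((1 : ℝ), (0 : E)) r :=
    (hasDerivAt_id r).prodMk (hasDerivAt_const r y)
  have hd : DifferentiableAt ℝ (fun z => G z (0, v) (0, v)) (r, y) :=
    ((hG.differentiableAt hx).clm_apply (differentiableAt_const _)).clm_apply
      (differentiableAt_const _)
  have h := HasFDerivAt.comp_hasDerivAt r hd.hasFDerivAt hcurve
  rw [← fderiv_apply_apply (hG.differentiableAt hx)] at h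
  have hc := hG.christoffel_fst hx (0, v) (0, v)
  have he : 2 * shapeForm G (r, y) v v = fderiv ℝ G (r, y) (1, 0) (0, v) (0, v) := by
    rw [shapeForm_apply]
    linarith
  rw [he]
  exact h

/-- The derivative of `g_r` in `r` is `-2` times the second fundamental form. -/
lemma IsMetricFamily.hasDerivAt (hg : IsMetricFamily g) (r : ℝ) (b : B) (v : E) :
    HasDerivAt (fun s => (g s b : E →L[ℝ] E →L[ℝ] ℝ) v v)
      (2 * shapeForm (inChart (cylinder g) (r, b)) (extChartAt (𝓘(ℝ, ℝ).prod I) (r, b) (r, b))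
        v v) r := by
  have hx : extChartAt (𝓘(ℝ, ℝ).prod I) (r, b) (r, b) = (r, extChartAt I b b) := by
    rw [extChartAt_prod]; rfl
  have hmem := mem_extChartAt_target (I := 𝓘(ℝ, ℝ).prod I) (r, b)
  rw [hx] at hmem ⊢
  have h := (hg.isCylindricalOn (r, b)).hasDerivAt hmem v
  have heq : (fun s => inChart (cylinder g) (r, b) (s, extChartAt I b b) (0, v) (0, v)) =
      fun s => (g s b : E →L[ℝ] E →L[ℝ] ℝ) v v := by
    funext s
    refine (inChart_cylinder g (r, b) (z := (s, extChartAt I b b)) (mem_extChartAt_target b)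
      (0, v) (0, v)).trans ?_
    rw [zero_mul, zero_add]
    exact inChart_self (g s) b v v
  rwa [heq] at h

lemma NegativeDefiniteII.monotone (hII : NegativeDefiniteII g) (hg : IsMetricFamily g) (b : B)
    (v : E) : Monotone fun s => (g s b : E →L[ℝ] E →L[ℝ] ℝ) v v :=
  monotone_of_hasDerivAt_nonneg (fun r => hg.hasDerivAt r b v)
    fun r => mul_nonneg zero_le_two (hII.shapeForm_nonneg hg r b v)

/-- In a frame orthogonal for both `g_r` and `g_s`, the determinants are products of diagonal
entries, each nondecreasing in the parameter. -/
lemma NegativeDefiniteII.gramDet_le (hII : NegativeDefiniteII g) (hg : IsMetricFamily g)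
    (hd : SimultaneouslyDiagonalizable g) {r s : ℝ} (hrs : r ≤ s) (b₀ : B) {y : E}
    (hy : y ∈ (extChartAt I b₀).target) :
    0 ≤ gramDet (Module.finBasis ℝ E) (inChart (g r) b₀ y) ∧
      gramDet (Module.finBasis ℝ E) (inChart (g r) b₀ y) ≤
        gramDet (Module.finBasis ℝ E) (inChart (g s) b₀ y) := by
  set x := (extChartAt I b₀).symm y
  obtain ⟨U, -, hxU, X, hX, hortho⟩ := hd x
  let D : E →L[ℝ] E := mfderiv 𝓘(ℝ, E) I (extChartAt I b₀).symm y
  have hD : Function.Injective D.toLinearMap := mfderiv_extChartAt_symm_injective hy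
  let β : Module.Basis (Fin (Module.finrank ℝ E)) ℝ E := hX.toBasisAt hxU
  -- The orthogonal frame is pulled back to coordinates through the derivative of the inverse chart.
  let b' := β.map (LinearEquiv.ofInjectiveEndo D.toLinearMap hD).symm
  have hb' (i) : D (b' i) = X i x := by
    have h₁ : D (b' i) = (LinearEquiv.ofInjectiveEndo D.toLinearMap hD)
      ((LinearEquiv.ofInjectiveEndo D.toLinearMap hD).symm (β i)) := rfl
    rw [h₁, LinearEquiv.apply_symm_apply]
    exact hX.toBasisAt_coe hxU i
  have hA (t : ℝ) (i j) (hij : i ≠ j) : inChart (g t) b₀ y (b' i) (b' j) = 0 := by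
    have h₁ : inChart (g t) b₀ y (b' i) (b' j) =
      (g t x : E →L[ℝ] E →L[ℝ] ℝ) (D (b' i)) (D (b' j)) := rfl
    rw [h₁, hb', hb']
    exact hortho t x hxU i j hij
  have h0 (t : ℝ) (v : E) : 0 ≤ inChart (g t) b₀ y v v := hg.apply_nonneg t x (D v)
  exact ⟨gramDet_nonneg_of_orthogonal _ b' (hA r) (h0 r),
    gramDet_le_of_orthogonal _ b' (hA r) (hA s) (h0 r) fun v => hII.monotone hg x (D v) hrs⟩

omit [FiniteDimensional ℝ E] in
lemma IsMetricFamily.continuousOn_inChart (hg : IsMetricFamily g) (r : ℝ) (b : B) (v w : E) :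
    ContinuousOn (fun y => inChart (g r) b y v w) (extChartAt I b).target := by
  have h := (IsRiemannianMetric.contDiffOn_inChart_apply hg (r, b) (0, v) (0, w)).continuousOn
  have h' := h.comp (f := fun y : E => (r, y)) (s := (extChartAt I b).target) (by fun_prop)
    (fun y hy => mem_target_cylinder.2 hy)
  refine h'.congr fun y hy => ?_
  refine ((inChart_cylinder g (r, b) (z := (r, y)) hy (0, v) (0, w)).trans ?_).symm
  rw [zero_mul, zero_add]

end Monotone

/-! ### Finite volume of the cylinder over the product. -/

section FiniteVolume

variable {E : Type*} [NormedAddCommGroup E] [NormedSpace ℝ E] [FiniteDimensional ℝ E]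
  [MeasurableSpace E] [BorelSpace E]
  {H : Type*} [TopologicalSpace H] {I : ModelWithCorners ℝ E H} [I.Boundaryless]
  {B : Type*} [TopologicalSpace B] [ChartedSpace H B] [IsManifold I ∞ B]
  [SecondCountableTopology B] [MeasurableSpace B] [BorelSpace B]
  {E' : Type*} [NormedAddCommGroup E'] [NormedSpace ℝ E'] [FiniteDimensional ℝ E']
  [MeasurableSpace E'] [BorelSpace E']
  {H' : Type*} [TopologicalSpace H'] {I' : ModelWithCorners ℝ E' H'} [I'.Boundaryless]
  {B' : Type*} [TopologicalSpace B'] [ChartedSpace H' B'] [IsManifold I' ∞ B']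
  [SecondCountableTopology B'] [MeasurableSpace B'] [BorelSpace B']
  {g : ℝ → FormField I B} {g' : ℝ → FormField I' B'}

theorem riemannianVolume_cylinder_prodFamily_lt_top_left (hg : IsMetricFamily g)
    (hg' : IsMetricFamily g') (hd' : SimultaneouslyDiagonalizable g')
    (hII : NegativeDefiniteII (prodFamily g g'))
    (hv : riemannianVolume (cylinder g) (Set.Iio (0 : ℝ) ×ˢ (Set.univ : Set B)) < ⊤)
    (hv' : riemannianVolume (g' 0) (Set.univ : Set B') < ⊤) :
    riemannianVolume (cylinder (prodFamily g g'))
      (Set.Iio (0 : ℝ) ×ˢ (Set.univ : Set (B × B'))) < ⊤ := by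
  refine riemannianVolume_lt_top_of_product_charts (g' := cylinder g) (g'' := g' 0)
    (ContinuousLinearEquiv.prodAssoc ℝ ℝ E E') (e := fun z => (z.1.1, z.1.2, z.2)) (by fun_prop)
    (measurableSet_Iio.prod MeasurableSet.univ) (isOpen_Iio.prod isOpen_univ) ?_ hv hv'
    (fun x' v w => (IsRiemannianMetric.contDiffOn_inChart_apply hg x' v w).continuousOn)
    (fun x'' v w => hg'.continuousOn_inChart 0 x'' v w) ?_
  · ext z; simp
  rintro ⟨r, b, b'⟩
  refine ⟨(r, b), b', ?_, ?_⟩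
  · ext ⟨⟨s, y⟩, y'⟩
    exact (mem_target_cylinder.trans mem_target_prod).trans
      (and_congr_left fun _ => (mem_target_cylinder (p := (r, b)) (z := (s, y))).symm)
  · rintro ⟨s, y⟩ hy y' hy'
    have hy := mem_target_cylinder.1 hy
    -- The second summand is `g'_s` at the current `s`, which varies with the point of the first
    -- factor; `s < 0` permits comparison with `g'_0`.
    refine ⟨?_, fun hs => ⟨inChart (g' s) b' y', ?_,
      (hII.right hg hg' b).gramDet_le hg' hd' ?_ b' hy'⟩⟩
    · rw [extChartAt_symm_cylinder, extChartAt_symm_cylinder, extChartAt_symm_prod]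
      rfl
    · rintro ⟨⟨a, v⟩, v'⟩ ⟨⟨c, w⟩, w'⟩
      rw [inChart_cylinder g (r, b) (z := (s, y)) hy]
      refine (inChart_cylinder (prodFamily g g') (r, b, b') (z := (s, y, y'))
        (mem_target_prod.2 ⟨hy, hy'⟩) (a, v, v') (c, w, w')).trans ?_
      rw [inChart_prodFamily g g' s b b' hy hy', add_assoc]
    · rw [extChartAt_symm_cylinder] at hs
      exact (Set.mem_Iio.1 hs.1).le

theorem riemannianVolume_cylinder_prodFamily_lt_top_right (hg : IsMetricFamily g)
    (hg' : IsMetricFamily g') (hd : SimultaneouslyDiagonalizable g)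
    (hII : NegativeDefiniteII (prodFamily g g'))
    (hv' : riemannianVolume (cylinder g') (Set.Iio (0 : ℝ) ×ˢ (Set.univ : Set B')) < ⊤)
    (hv : riemannianVolume (g 0) (Set.univ : Set B) < ⊤) :
    riemannianVolume (cylinder (prodFamily g g'))
      (Set.Iio (0 : ℝ) ×ˢ (Set.univ : Set (B × B'))) < ⊤ := by
  refine riemannianVolume_lt_top_of_product_charts (g' := cylinder g') (g'' := g 0)
    -- The cylinder over the second factor now comes first, so after reassociating the two factors
    -- are swapped back.
    ((ContinuousLinearEquiv.prodAssoc ℝ ℝ E' E).trans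
      ((ContinuousLinearEquiv.refl ℝ ℝ).prodCongr (ContinuousLinearEquiv.prodComm ℝ E' E)))
    (e := fun z => (z.1.1, z.2, z.1.2)) (by fun_prop)
    (measurableSet_Iio.prod MeasurableSet.univ) (isOpen_Iio.prod isOpen_univ) ?_ hv' hv
    (fun x' v w => (IsRiemannianMetric.contDiffOn_inChart_apply hg' x' v w).continuousOn)
    (fun x'' v w => hg.continuousOn_inChart 0 x'' v w) ?_
  · ext z; simp
  rintro ⟨r, b, b'⟩
  refine ⟨(r, b'), b, ?_, ?_⟩
  · ext ⟨⟨s, y'⟩, y⟩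
    exact ((mem_target_cylinder.trans mem_target_prod).trans and_comm).trans
      (and_congr_left fun _ => (mem_target_cylinder (p := (r, b')) (z := (s, y'))).symm)
  · rintro ⟨s, y'⟩ hy' y hy
    have hy' := mem_target_cylinder.1 hy'
    refine ⟨?_, fun hs => ⟨inChart (g s) b y, ?_,
      (hII.left hg hg' b').gramDet_le hg hd ?_ b hy⟩⟩
    · rw [extChartAt_symm_cylinder, extChartAt_symm_cylinder, extChartAt_symm_prod]
      rfl
    · rintro ⟨⟨a, v'⟩, v⟩ ⟨⟨c, w'⟩, w⟩
      rw [inChart_cylinder g' (r, b') (z := (s, y')) hy']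
      refine (inChart_cylinder (prodFamily g g') (r, b, b') (z := (s, y, y'))
        (mem_target_prod.2 ⟨hy, hy'⟩) (a, v, v') (c, w, w')).trans ?_
      rw [inChart_prodFamily g g' s b b' hy hy', add_assoc]
      exact congrArg (a * c + ·) (add_comm _ _)
    · rw [extChartAt_symm_cylinder] at hs
      exact (Set.mem_Iio.1 hs.1).le

end FiniteVolume

end CylinderGeometry

end

theorem mainTheorem3 (n₁ n₂ : ℕ)
    {B₁ : Type*} [TopologicalSpace B₁] [ChartedSpace (EuclideanSpace ℝ (Fin n₁)) B₁]
    [IsManifold (𝓡 n₁) ∞ B₁] [T2Space B₁] [SecondCountableTopology B₁]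
    [MeasurableSpace B₁] [BorelSpace B₁]
    {B₂ : Type*} [TopologicalSpace B₂] [ChartedSpace (EuclideanSpace ℝ (Fin n₂)) B₂]
    [IsManifold (𝓡 n₂) ∞ B₂] [T2Space B₂] [SecondCountableTopology B₂]
    [MeasurableSpace B₂] [BorelSpace B₂]
    (g₁ : ℝ → CylinderGeometry.FormField (𝓡 n₁) B₁)
    (g₂ : ℝ → CylinderGeometry.FormField (𝓡 n₂) B₂)
    (hg₁ : CylinderGeometry.IsMetricFamily g₁) (hg₂ : CylinderGeometry.IsMetricFamily g₂)
    (hd₁ : CylinderGeometry.SimultaneouslyDiagonalizable g₁)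
    (hd₂ : CylinderGeometry.SimultaneouslyDiagonalizable g₂)
    (hII : CylinderGeometry.NegativeDefiniteII (CylinderGeometry.prodFamily g₁ g₂)) :
    -- negative curvature
    (CylinderGeometry.NegativeCurvature (CylinderGeometry.cylinder g₁) →
      CylinderGeometry.NegativeCurvature (CylinderGeometry.cylinder g₂) →
      CylinderGeometry.NegativeCurvature
        (CylinderGeometry.cylinder (CylinderGeometry.prodFamily g₁ g₂))) ∧
    -- bounded curvature
    (CylinderGeometry.BoundedCurvature (CylinderGeometry.cylinder g₁) →
      CylinderGeometry.BoundedCurvature (CylinderGeometry.cylinder g₂) →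
      CylinderGeometry.BoundedII (CylinderGeometry.prodFamily g₁ g₂) →
      CylinderGeometry.BoundedCurvature
        (CylinderGeometry.cylinder (CylinderGeometry.prodFamily g₁ g₂))) ∧
    -- finite volume over the negative reals
    ((CylinderGeometry.riemannianVolume (CylinderGeometry.cylinder g₁)
            (Set.Iio (0 : ℝ) ×ˢ (Set.univ : Set B₁)) < ⊤ ∧
          CylinderGeometry.riemannianVolume (g₂ 0) (Set.univ : Set B₂) < ⊤) ∨
        (CylinderGeometry.riemannianVolume (CylinderGeometry.cylinder g₂)
            (Set.Iio (0 : ℝ) ×ˢ (Set.univ : Set B₂)) < ⊤ ∧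
          CylinderGeometry.riemannianVolume (g₁ 0) (Set.univ : Set B₁) < ⊤) →
      CylinderGeometry.riemannianVolume
        (CylinderGeometry.cylinder (CylinderGeometry.prodFamily g₁ g₂))
        (Set.Iio (0 : ℝ) ×ˢ (Set.univ : Set (B₁ × B₂))) < ⊤) := by
  refine ⟨CylinderGeometry.negativeCurvature_cylinder_prodFamily hg₁ hg₂ hII,
    CylinderGeometry.boundedCurvature_cylinder_prodFamily hg₁ hg₂ hII, ?_⟩
  rintro (⟨h₁, h₂⟩ | ⟨h₂, h₁⟩)
  · exact CylinderGeometry.riemannianVolume_cylinder_prodFamily_lt_top_left hg₁ hg₂ hd₂ hII h₁ h₂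
  · exact CylinderGeometry.riemannianVolume_cylinder_prodFamily_lt_top_right hg₁ hg₂ hd₁ hII h₂ h₁
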